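/- Let $G=(V,E)$ be a finite connected simple undirected graph with $n$ vertices. The lazy random walk on $G$ is the discrete-time Markov chain that at each step stays where it is with probability $1/2$ and otherwise moves to a uniformly random neighbour; write $p^t_{u,v}$ for the probability that the walk started at $u$ is at $v$ at time $t$ (if $n=1$ the walk stays put). Define the following quantities. - The mixing time $t_{\mathrm{mix}}=\min\bigl\{t\ge 0:\ \max_{u,v\in V}\tfrac12\sum_{x\in V}|p^t_{u,x}-p^t_{v,x}|\le 1/e\bigr\}$. - The meeting time $t_{\mathrm{meet}}=\max_{u,v\in V}t_{\mathrm{meet}}(u,v)$, where $t_{\mathrm{meet}}(u,v)$ is the expected first time $t\ge0$ at which two independent lazy walks started at $u$ and $v$ are at the same vertex. - The coalescence time $t_{\mathrm{coal}}=\mathbb E\bigl[\min\{t\ge0: |S_t|=1\}\bigr]$, where $S_0=V$ and $S_{t+1}=\{Y_v(t): v\in S_t\}$, the random variables $Y_v(t)$ ($v\in V$, $t\ge0$) being independent with $Y_v(t)=v$ with probability $1/2$ and $Y_v(t)=u$ with probability $\frac{1}{2\deg(v)}$ for each neighbour $u$ of $v$ (if $n=1$, $Y_v(t)=v$). Then there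 is an absolute constant $C>0$ such that, for every finite connected graph $G$, $t_{\mathrm{meet}}$ and $t_{\mathrm{coal}}$ are finite and $$t_{\mathrm{coal}}\ \le\ C\,t_{\mathrm{meet}}\left(1+\sqrt{\frac{t_{\mathrm{mix}}}{t_{\mathrm{meet}}}}\cdot\log n\right)$$ (natural logarithm; for $n=1$ all three times are $0$ and the right-hand side is read as $0$). Consequently, whenever $t_{\mathrm{meet}}\ge t_{\mathrm{mix}}\log^2 n$, one has $t_{\mathrm{coal}}\le C\,t_{\mathrm{meet}}$. -/

import Mathlib

open MeasureTheory
open scoped ENNReal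

namespace LazyWalk

/-- One-step transition probabilities of the lazy random walk on `G`: stay put with probability
`1/2`, otherwise move to a uniformly random neighbour. (A vertex without neighbours, which a
connected graph has only if it is a single vertex, is absorbing.) -/
noncomputable def transition {V : Type*} [Fintype V] [DecidableEq V] (G : SimpleGraph V)
    [DecidableRel G.Adj] (u v : V) : ℝ≥0∞ :=
  if G.degree u = 0 then (if v = u then 1 else 0)
  else if v = u then 1 / 2
  else if G.Adj u v then 1 / (2 * (G.degree u : ℝ≥0∞))
  else 0

theorem sum_transition {V : Type*} [Fintype V] [DecidableEq V] (G : SimpleGraph V)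
    [DecidableRel G.Adj] (u : V) : ∑ v, transition G u v = 1 := by
  by_cases h : G.degree u = 0
  · simp [transition, h]
  · have h1 : ∀ v, transition G u v =
        (if v = u then 1 / 2 else 0) +
          (if v ∈ G.neighborFinset u then 1 / (2 * (G.degree u : ℝ≥0∞)) else 0) := by
      intro v
      by_cases hv : v = u
      · subst hv
        simp [transition, h]
      · simp [transition, h, hv]
    have h0 : (G.degree u : ℝ≥0∞) ≠ 0 := by exact_mod_cast h
    simp only [h1, Finset.sum_add_distrib, Finset.sum_ite_eq', Finset.mem_univ, if_true]
    rw [Finset.sum_ite_mem, Finset.univ_inter, Finset.sum_const, G.card_neighborFinset_eq_degree,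
      nsmul_eq_mul, one_div, one_div, ENNReal.mul_inv (Or.inl (by simp)) (Or.inl (by simp)),
      mul_left_comm, ENNReal.mul_inv_cancel h0 (by simp), mul_one, ENNReal.inv_two_add_inv_two]

/-- The law of one step of the lazy random walk from `u`. -/
noncomputable def step {V : Type*} [Fintype V] [DecidableEq V] (G : SimpleGraph V)
    [DecidableRel G.Adj] (u : V) : PMF V :=
  PMF.ofFintype (transition G u) (sum_transition G u)

/-- The law of a family `ω` of independent moves: `ω t v` is the vertex to which a particle that
is at `v` at time `t` moves at time `t + 1`. The `ω t v`, for all times `t` and all vertices `v`,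
are independent, and `ω t v` has the law `step G v`. -/
noncomputable def moves {V : Type*} [Fintype V] [DecidableEq V] [MeasurableSpace V]
    (G : SimpleGraph V) [DecidableRel G.Adj] : Measure (ℕ → V → V) :=
  Measure.infinitePi fun _ : ℕ => Measure.pi fun v : V => (step G v).toMeasure

/-- The trajectory of a particle that starts at `u`. Under `moves G` this is the lazy random walk
on `G` started at `u`. -/
def walk {V : Type*} (ω : ℕ → V → V) (u : V) : ℕ → V
  | 0 => u
  | t + 1 => ω t (walk ω u t)

/-- The set `S_t` of occupied vertices: `S_{t+1} = {ω t v | v ∈ S_t}`. Under `moves G` this is the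
process of coalescing lazy random walks started from one particle on each vertex of `S₀`. -/
def active {V : Type*} [DecidableEq V] (ω : ℕ → V → V) (S₀ : Finset V) : ℕ → Finset V
  | 0 => S₀
  | t + 1 => (active ω S₀ t).image (ω t)

/-- The first time at which only one particle is left (`⊤` if there is none). -/
noncomputable def coalTime {V : Type*} [DecidableEq V] (ω : ℕ → V → V) (S₀ : Finset V) : ℕ∞ :=
  ⨅ (t : ℕ) (_ : (active ω S₀ t).card = 1), (t : ℕ∞)

/-- The expected coalescence time of lazy walks started from one particle per vertex. -/
noncomputable def tCoal {V : Type*} [Fintype V] [DecidableEq V] [MeasurableSpace V]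
    (G : SimpleGraph V) [DecidableRel G.Adj] : ℝ≥0∞ :=
  ∫⁻ ω, (coalTime ω Finset.univ : ℝ≥0∞) ∂(moves G)

/-- The first time at which the walk from `u` driven by `ω` and the walk from `v` driven by `ω'`
are at the same vertex (`⊤` if there is none). -/
noncomputable def meetTime {V : Type*} (ω ω' : ℕ → V → V) (u v : V) : ℕ∞ :=
  ⨅ (t : ℕ) (_ : walk ω u t = walk ω' v t), (t : ℕ∞)

/-- The expected meeting time of two independent lazy walks started at `u` and `v`. -/
noncomputable def meet {V : Type*} [Fintype V] [DecidableEq V] [MeasurableSpace V]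
    (G : SimpleGraph V) [DecidableRel G.Adj] (u v : V) : ℝ≥0∞ :=
  ∫⁻ p : (ℕ → V → V) × (ℕ → V → V), (meetTime p.1 p.2 u v : ℝ≥0∞) ∂((moves G).prod (moves G))

/-- The worst-case expected meeting time. -/
noncomputable def tMeet {V : Type*} [Fintype V] [DecidableEq V] [MeasurableSpace V]
    (G : SimpleGraph V) [DecidableRel G.Adj] : ℝ≥0∞ :=
  ⨆ (u : V) (v : V), meet G u v

/-- The probability that the lazy walk started at `u` is at `v` at time `t`. -/
noncomputable def prob {V : Type*} [Fintype V] [DecidableEq V] [MeasurableSpace V]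
    (G : SimpleGraph V) [DecidableRel G.Adj] (t : ℕ) (u v : V) : ℝ :=
  (moves G).real {ω | walk ω u t = v}

/-- The total variation distance of two probability vectors. -/
noncomputable def tvDist {V : Type*} [Fintype V] (p q : V → ℝ) : ℝ :=
  (1 / 2) * ∑ x, |p x - q x|

/-- The largest total variation distance between the laws at time `t` of two lazy walks. -/
noncomputable def dBar {V : Type*} [Fintype V] [DecidableEq V] [MeasurableSpace V]
    (G : SimpleGraph V) [DecidableRel G.Adj] (t : ℕ) : ℝ :=
  ⨆ (u : V) (v : V), tvDist (prob G t u) (prob G t v)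

/-- The mixing time, with threshold `1/e`. -/
noncomputable def tMix {V : Type*} [Fintype V] [DecidableEq V] [MeasurableSpace V]
    (G : SimpleGraph V) [DecidableRel G.Adj] : ℕ :=
  sInf {t : ℕ | dBar G t ≤ 1 / Real.exp 1}

end LazyWalk

/-!
# Coalescence, meeting and mixing times of lazy random walks

Let `p` be the probability that two independent stationary walks meet within `T = tMix` steps. By
stationarity `p` is at most additive in `T`, and within `2 * tMeet` steps any two walks meet with
probability at least `1 / 2`, so `p` is at least of order `tMix / tMeet` when `tMix ≤ tMeet`
(`div_le_statMeet`). It then suffices to reduce `n` particles to one within an expected number of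
blocks of length `3 * tMix` of order `1 / p + log n / √p`.

In each block, `k` particles lose at least of order `k * p * min k (1 / √p)` in mean
(`block_loss_ge`), for the following reasons.

* During the first `2 * tMix` steps of the block collisions are ignored, which only leaves more
  particles (`flowExp_image_le`). By reversibility every particle is afterwards, with probability
  `1 / 4` and independently of the others, at a stationary position (`mul_le_stepPow_add_self`).
* From *every* vertex, a walk meets a stationary walk within `T` steps with probability at most
  `3 * √p` (`avgMeet_le`): if it meets the stationary walk at a vertex from which this is likely,
  then the stationary walk visits such a vertex, which has a small probability because such a visit
  makes it likely to meet a second stationary walk. Hence three stationary walks merge with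
  probability at most `9 * p * √p` (`sum_flowExp_triple_le`), as two of them have to meet first.
* In a group of at most of order `1 / √p` particles, the collisions of pairs therefore outweigh
  those of triples, and the mean loss is of order `m ^ 2 * p` for `m` particles
  (`group_loss_ge`). The losses of disjoint groups add up (`mul_le_loss`).

The function `(1 - 1 / k) / p + log k / √p` of the number `k` of particles is concave and decreases
in mean by a constant in each block, which bounds the expected number of blocks
(`sum_card_ne_one_le_of_statMeet`). If `tMeet < tMix`, blocks of length of order `tMeet` and groups
of two particles give the bound `tMeet * log n`, which is enough
(`sum_card_ne_one_le_of_half_le_meetProb`).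

All of this takes place in finite sums: `flowExp` is the expectation over the random map that sends
each vertex to the position at time `t` of the walk started there, and `meetProb` is given by its
recursion. The connection with the measure `moves G` is made by first-step analysis
(`lintegral_moves`).
-/

set_option linter.unusedSectionVars false

namespace LazyWalk

/-! ### Expectations over independent coordinates -/

section IndepExp

variable {ι κ β γ : Type*} [Fintype ι] [DecidableEq ι] [Fintype κ] [DecidableEq κ]
  [Fintype β] [Fintype γ]

/-- The rows `q i` are probability vectors. -/
structure IsStoch {ι β : Type*} [Fintype β] (q : ι → β → ℝ) : Prop where
  nonneg : ∀ i b, 0 ≤ q i b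
  sum_eq_one : ∀ i, ∑ b, q i b = 1

/-- The expectation of `φ z`, where the coordinates `z i` are independent and `z i` has the
law `q i`. -/
noncomputable def indepExp (q : ι → β → ℝ) (φ : (ι → β) → ℝ) : ℝ :=
  ∑ z : ι → β, (∏ i, q i (z i)) * φ z

theorem indepExp_mono {q : ι → β → ℝ} (hq : IsStoch q) {φ ψ : (ι → β) → ℝ}
    (h : ∀ z, φ z ≤ ψ z) : indepExp q φ ≤ indepExp q ψ :=
  Finset.sum_le_sum fun z _ =>
    mul_le_mul_of_nonneg_left (h z) (Finset.prod_nonneg fun i _ => hq.nonneg i _)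

theorem indepExp_const {q : ι → β → ℝ} (hq : IsStoch q) (c : ℝ) :
    indepExp q (fun _ => c) = c := by
  have h := Finset.prod_univ_sum (fun _ : ι => (Finset.univ : Finset β)) q
  simp only [hq.sum_eq_one, Finset.prod_const_one, Fintype.piFinset_univ] at h
  rw [indepExp, ← Finset.sum_mul, ← h, one_mul]

theorem indepExp_sub (q : ι → β → ℝ) (φ ψ : (ι → β) → ℝ) :
    indepExp q (fun z => φ z - ψ z) = indepExp q φ - indepExp q ψ := by
  simp [indepExp, mul_sub, Finset.sum_sub_distrib]

theorem indepExp_add (q : ι → β → ℝ) (φ ψ : (ι → β) → ℝ) :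
    indepExp q (fun z => φ z + ψ z) = indepExp q φ + indepExp q ψ := by
  simp [indepExp, mul_add, Finset.sum_add_distrib]

theorem indepExp_const_mul (q : ι → β → ℝ) (c : ℝ) (φ : (ι → β) → ℝ) :
    indepExp q (fun z => c * φ z) = c * indepExp q φ := by
  simp only [indepExp, Finset.mul_sum]
  exact Finset.sum_congr rfl fun z _ => by ring

theorem indepExp_sum {α : Type*} (s : Finset α) (q : ι → β → ℝ) (φ : α → (ι → β) → ℝ) :
    indepExp q (fun z => ∑ a ∈ s, φ a z) = ∑ a ∈ s, indepExp q (φ a) := by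
  simp only [indepExp, Finset.mul_sum]
  exact Finset.sum_comm

/-- Marginals of independent coordinates. -/
theorem indepExp_comp_injective {q : ι → β → ℝ} (hq : IsStoch q) {e : κ → ι}
    (he : Function.Injective e) (φ : (κ → β) → ℝ) :
    indepExp q (fun z => φ (z ∘ e)) = indepExp (fun k => q (e k)) φ := by
  classical
  have key : ∀ y : κ → β,
      indepExp q (fun z => if z ∘ e = y then 1 else 0) = ∏ k, q (e k) (y k) := by
    intro y
    have h := Finset.prod_univ_sum (fun _ : ι => (Finset.univ : Finset β))
      (fun i b => q i b * if ∀ k, e k = i → b = y k then 1 else 0)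
    rw [Fintype.piFinset_univ] at h
    have h1 : ∀ z : ι → β, (∏ i, (if ∀ k, e k = i → z i = y k then (1 : ℝ) else 0)) =
        if z ∘ e = y then 1 else 0 := by
      intro z
      rw [Finset.prod_boole]
      congr 1
      simp only [Finset.mem_univ, forall_const, eq_iff_iff, funext_iff, Function.comp]
      exact ⟨fun h k => h _ k rfl, fun h i k hk => by rw [← hk, h k]⟩
    simp only [Finset.prod_mul_distrib, h1] at h
    rw [indepExp, ← h]
    have h2 : ∀ i, i ∉ Set.range e →
        ∑ b, q i b * (if ∀ k, e k = i → b = y k then (1 : ℝ) else 0) = 1 := by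
      intro i hi
      refine Eq.trans ?_ (hq.sum_eq_one i)
      refine Finset.sum_congr rfl fun b _ => ?_
      rw [if_pos, mul_one]
      exact fun k hk => absurd ⟨k, hk⟩ hi
    refine (Fintype.prod_of_injective e he _ _ h2 fun k => ?_).symm
    have h3 : ∀ b, (∀ k', e k' = e k → b = y k') ↔ b = y k :=
      fun b => ⟨fun h => h k rfl, fun h k' hk' => by rw [he hk', h]⟩
    simp [h3]
  have h1 : ∀ z : ι → β, φ (z ∘ e) = ∑ y, φ y * (if z ∘ e = y then 1 else 0) := by
    intro z; simp
  simp only [h1]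
  rw [indepExp_sum]
  simp only [indepExp_const_mul, key]
  exact Finset.sum_congr rfl fun y _ => mul_comm _ _

theorem indepExp_fin_succ {n : ℕ} (q : Fin (n + 1) → β → ℝ) (φ : (Fin (n + 1) → β) → ℝ) :
    indepExp q φ = ∑ a, q 0 a * indepExp (fun i => q i.succ) (fun z => φ (Fin.cons a z)) := by
  simp only [indepExp, Finset.mul_sum]
  rw [← (Fin.consEquiv fun _ : Fin (n + 1) => β).sum_comp, Fintype.sum_prod_type]
  refine Finset.sum_congr rfl fun a _ => Finset.sum_congr rfl fun z _ => ?_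
  simp [Fin.consEquiv, Fin.prod_univ_succ, mul_assoc]

theorem indepExp_pair {q : ι → β → ℝ} (hq : IsStoch q) {i j : ι} (hij : i ≠ j)
    (φ : β → β → ℝ) :
    indepExp q (fun z => φ (z i) (z j)) = ∑ a, ∑ b, q i a * q j b * φ a b := by
  have he : Function.Injective ![i, j] := by
    intro a b; fin_cases a <;> fin_cases b <;> simp [hij, hij.symm]
  have h := indepExp_comp_injective hq he (fun z => φ (z 0) (z 1))
  simp only [Function.comp, Matrix.cons_val_zero, Matrix.cons_val_one] at h
  rw [h]
  simp [indepExp_fin_succ, Finset.mul_sum, mul_assoc]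
  simp [indepExp]

theorem indepExp_triple {q : ι → β → ℝ} (hq : IsStoch q) {i j k : ι} (hij : i ≠ j) (hik : i ≠ k)
    (hjk : j ≠ k) (φ : β → β → β → ℝ) :
    indepExp q (fun z => φ (z i) (z j) (z k)) =
      ∑ a, ∑ b, ∑ c, q i a * q j b * q k c * φ a b c := by
  have he : Function.Injective ![i, j, k] := by
    intro a b
    fin_cases a <;> fin_cases b <;> simp [hij, hij.symm, hik, hik.symm, hjk, hjk.symm]
  have h := indepExp_comp_injective hq he (fun z => φ (z 0) (z 1) (z 2))
  simp only [Function.comp, Matrix.cons_val_zero, Matrix.cons_val_one, Matrix.cons_val] at h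
  rw [h]
  simp [indepExp_fin_succ, Finset.mul_sum, mul_assoc]
  simp [indepExp]
  rfl

/-- Two successive independent moves of each coordinate. -/
theorem indepExp_bind (q : ι → β → ℝ) (r : β → γ → ℝ) (φ : (ι → γ) → ℝ) :
    indepExp q (fun f => indepExp (fun i => r (f i)) φ) =
      indepExp (fun i c => ∑ b, q i b * r b c) φ := by
  simp only [indepExp, Finset.mul_sum]
  rw [Finset.sum_comm]
  refine Finset.sum_congr rfl fun z _ => ?_
  have h := Finset.prod_univ_sum (fun _ : ι => (Finset.univ : Finset β))
    (fun i b => q i b * r b (z i))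
  rw [Fintype.piFinset_univ] at h
  rw [h, Finset.sum_mul]
  refine Finset.sum_congr rfl fun f _ => ?_
  rw [Finset.prod_mul_distrib, mul_assoc]

theorem indepExp_dirac [DecidableEq β] (f : ι → β) (φ : (ι → β) → ℝ) :
    indepExp (fun i b => if b = f i then 1 else 0) φ = φ f := by
  rw [indepExp, Finset.sum_eq_single f]
  · simp
  · intro z _ hz
    have : ∃ i, z i ≠ f i := by
      by_contra! h
      exact hz (funext h)
    obtain ⟨i, hi⟩ := this
    rw [Finset.prod_eq_zero (Finset.mem_univ i) (by simp [hi]), zero_mul]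
  · simp

theorem indepExp_map [DecidableEq γ] (q : ι → β → ℝ) (g : β → γ) (φ : (ι → γ) → ℝ) :
    indepExp q (fun z => φ (fun i => g (z i))) =
      indepExp (fun i c => ∑ b, q i b * if c = g b then 1 else 0) φ := by
  rw [← indepExp_bind]
  simp only [indepExp_dirac]

end IndepExp

/-! ### Flows of coalescing walks and meeting probabilities -/

section Flow

variable {V : Type*} [Fintype V] [DecidableEq V]

/-- The expectation of `φ g`, where the random map `g : V → V` is the composition of `t`
independent rounds of moves; in each round every vertex chooses its image independently of the
others, `v` with the law `P v`. Thus `g v` is the position at time `t` of the coalescing walk that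
starts at `v`. -/
noncomputable def flowExp (P : V → V → ℝ) : ℕ → ((V → V) → ℝ) → ℝ
  | 0, φ => φ id
  | t + 1, φ => indepExp P fun f => flowExp P t fun g => φ (g ∘ f)

/-- The `t`-step transition probabilities. -/
noncomputable def stepPow (P : V → V → ℝ) : ℕ → V → V → ℝ
  | 0, u, v => if v = u then 1 else 0
  | t + 1, u, v => ∑ x, P u x * stepPow P t x v

theorem flowExp_mono {P : V → V → ℝ} (hP : IsStoch P) (t : ℕ) {φ ψ : (V → V) → ℝ}
    (h : ∀ g, φ g ≤ ψ g) : flowExp P t φ ≤ flowExp P t ψ := by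
  induction t generalizing φ ψ with
  | zero => exact h _
  | succ t ih => exact indepExp_mono hP fun f => ih fun g => h _

theorem flowExp_const {P : V → V → ℝ} (hP : IsStoch P) (t : ℕ) (c : ℝ) :
    flowExp P t (fun _ => c) = c := by
  induction t with
  | zero => rfl
  | succ t ih => simp only [flowExp, ih, indepExp_const hP]

theorem flowExp_sub (P : V → V → ℝ) (t : ℕ) (φ ψ : (V → V) → ℝ) :
    flowExp P t (fun g => φ g - ψ g) = flowExp P t φ - flowExp P t ψ := by
  induction t generalizing φ ψ with
  | zero => rfl
  | succ t ih => simp only [flowExp, ih, indepExp_sub]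

theorem flowExp_const_mul (P : V → V → ℝ) (t : ℕ) (c : ℝ) (φ : (V → V) → ℝ) :
    flowExp P t (fun g => c * φ g) = c * flowExp P t φ := by
  induction t generalizing φ with
  | zero => rfl
  | succ t ih => simp only [flowExp, ih, indepExp_const_mul]

theorem flowExp_sum {α : Type*} (s : Finset α) (P : V → V → ℝ) (t : ℕ) (φ : α → (V → V) → ℝ) :
    flowExp P t (fun g => ∑ a ∈ s, φ a g) = ∑ a ∈ s, flowExp P t (φ a) := by
  induction t generalizing φ with
  | zero => rfl
  | succ t ih => simp only [flowExp, ih, indepExp_sum]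

theorem flowExp_nonneg {P : V → V → ℝ} (hP : IsStoch P) (t : ℕ) {φ : (V → V) → ℝ}
    (h : ∀ g, 0 ≤ φ g) : 0 ≤ flowExp P t φ :=
  (flowExp_const hP t 0).symm.le.trans (flowExp_mono hP t h)

theorem flowExp_add_time (P : V → V → ℝ) (s t : ℕ) (φ : (V → V) → ℝ) :
    flowExp P (s + t) φ = flowExp P s fun f => flowExp P t fun g => φ (g ∘ f) := by
  induction s generalizing φ with
  | zero => simp only [flowExp, Nat.zero_add, Function.comp_id]
  | succ s ih => simp only [Nat.succ_add, flowExp, ih]; rfl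

theorem isStoch_stepPow {P : V → V → ℝ} (hP : IsStoch P) (t : ℕ) : IsStoch (stepPow P t) := by
  induction t with
  | zero =>
    refine ⟨fun u v => ?_, fun u => by simp [stepPow]⟩
    rw [stepPow]; split_ifs <;> norm_num
  | succ t ih =>
    refine ⟨fun u v => Finset.sum_nonneg fun x _ => mul_nonneg (hP.nonneg _ _) (ih.nonneg _ _),
      fun u => ?_⟩
    simp only [stepPow]
    rw [Finset.sum_comm]
    simp only [← Finset.mul_sum, ih.sum_eq_one, mul_one, hP.sum_eq_one]

theorem stepPow_add (P : V → V → ℝ) (s t : ℕ) (u v : V) :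
    stepPow P (s + t) u v = ∑ x, stepPow P s u x * stepPow P t x v := by
  induction s generalizing u with
  | zero => simp [stepPow]
  | succ s ih =>
    simp only [Nat.succ_add, stepPow, ih, Finset.mul_sum, Finset.sum_mul]
    rw [Finset.sum_comm]
    simp only [mul_assoc]

theorem stepPow_one (P : V → V → ℝ) (u v : V) : stepPow P 1 u v = P u v := by
  simp [stepPow]

theorem stepPow_reversible {P : V → V → ℝ} {π : V → ℝ}
    (hrev : ∀ u v, π u * P u v = π v * P v u) (t : ℕ) (u v : V) :
    π u * stepPow P t u v = π v * stepPow P t v u := by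
  induction t generalizing u v with
  | zero => by_cases h : u = v <;> simp [stepPow, h, eq_comm]
  | succ t ih =>
    rw [stepPow_add P t 1 v u, stepPow, Finset.mul_sum, Finset.mul_sum]
    refine Finset.sum_congr rfl fun x _ => ?_
    rw [stepPow_one, ← mul_assoc, hrev, ← mul_assoc, ← ih]
    ring

end Flow

section Meeting

variable {V : Type*} [Fintype V] [DecidableEq V]

/-- One step of a pair of independent walks. -/
noncomputable def pairStep (P : V → V → ℝ) (g : V → V → ℝ) (x y : V) : ℝ :=
  ∑ a, ∑ b, P x a * P y b * g a b

/-- The probability that two independent walks started at `x` and `y` meet by time `t`. -/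
noncomputable def meetProb (P : V → V → ℝ) : ℕ → V → V → ℝ
  | 0, x, y => if x = y then 1 else 0
  | t + 1, x, y => if x = y then 1 else pairStep P (meetProb P t) x y

theorem pairStep_mono {P : V → V → ℝ} (hP : IsStoch P) {g h : V → V → ℝ}
    (hgh : ∀ a b, g a b ≤ h a b) (x y : V) : pairStep P g x y ≤ pairStep P h x y :=
  Finset.sum_le_sum fun a _ => Finset.sum_le_sum fun b _ =>
    mul_le_mul_of_nonneg_left (hgh a b) (mul_nonneg (hP.nonneg _ _) (hP.nonneg _ _))

theorem pairStep_fst {P : V → V → ℝ} (hP : IsStoch P) (g : V → ℝ) (x y : V) :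
    pairStep P (fun a _ => g a) x y = ∑ a, P x a * g a := by
  refine Finset.sum_congr rfl fun a _ => ?_
  rw [← Finset.sum_mul, ← Finset.mul_sum, hP.sum_eq_one, mul_one]

theorem pairStep_swap (P : V → V → ℝ) (g : V → V → ℝ) (x y : V) :
    pairStep P g x y = pairStep P (fun a b => g b a) y x := by
  rw [pairStep, Finset.sum_comm]
  simp only [pairStep, mul_comm]

theorem pairStep_snd {P : V → V → ℝ} (hP : IsStoch P) (g : V → ℝ) (x y : V) :
    pairStep P (fun _ b => g b) x y = ∑ b, P y b * g b := by
  rw [pairStep_swap, pairStep_fst hP]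

theorem pairStep_const {P : V → V → ℝ} (hP : IsStoch P) (c : ℝ) (x y : V) :
    pairStep P (fun _ _ => c) x y = c := by
  rw [pairStep_fst hP, ← Finset.sum_mul, hP.sum_eq_one, one_mul]

theorem pairStep_add (P : V → V → ℝ) (g h : V → V → ℝ) (x y : V) :
    pairStep P (fun a b => g a b + h a b) x y = pairStep P g x y + pairStep P h x y := by
  simp [pairStep, mul_add, Finset.sum_add_distrib]

theorem pairStep_sub (P : V → V → ℝ) (g h : V → V → ℝ) (x y : V) :
    pairStep P (fun a b => g a b - h a b) x y = pairStep P g x y - pairStep P h x y := by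
  simp [pairStep, mul_sub, Finset.sum_sub_distrib]

theorem pairStep_const_mul (P : V → V → ℝ) (c : ℝ) (g : V → V → ℝ) (x y : V) :
    pairStep P (fun a b => c * g a b) x y = c * pairStep P g x y := by
  simp only [pairStep, Finset.mul_sum]
  exact Finset.sum_congr rfl fun a _ => Finset.sum_congr rfl fun b _ => by ring

theorem pairStep_nonneg {P : V → V → ℝ} (hP : IsStoch P) {g : V → V → ℝ}
    (hg : ∀ a b, 0 ≤ g a b) (x y : V) : 0 ≤ pairStep P g x y :=
  (pairStep_const hP 0 x y).symm.le.trans (pairStep_mono hP hg x y)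

theorem meetProb_self (P : V → V → ℝ) (t : ℕ) (x : V) : meetProb P t x x = 1 := by
  cases t <;> simp [meetProb]

theorem meetProb_zero_of_ne (P : V → V → ℝ) {x y : V} (h : x ≠ y) : meetProb P 0 x y = 0 := by
  simp [meetProb, h]

theorem meetProb_succ_of_ne (P : V → V → ℝ) (t : ℕ) {x y : V} (h : x ≠ y) :
    meetProb P (t + 1) x y = pairStep P (meetProb P t) x y := by
  simp [meetProb, h]

theorem meetProb_symm (P : V → V → ℝ) (t : ℕ) (x y : V) :
    meetProb P t x y = meetProb P t y x := by
  induction t generalizing x y with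
  | zero => simp [meetProb, eq_comm]
  | succ t ih =>
    rcases eq_or_ne x y with rfl | h
    · rfl
    · rw [meetProb_succ_of_ne P t h, meetProb_succ_of_ne P t h.symm, pairStep_swap]
      congr 1
      ext a b
      exact ih b a

theorem meetProb_nonneg {P : V → V → ℝ} (hP : IsStoch P) (t : ℕ) (x y : V) :
    0 ≤ meetProb P t x y := by
  induction t generalizing x y with
  | zero => rw [meetProb]; split_ifs <;> norm_num
  | succ t ih =>
    rw [meetProb]; split_ifs
    · norm_num
    · exact pairStep_nonneg hP ih x y

theorem meetProb_le_one {P : V → V → ℝ} (hP : IsStoch P) (t : ℕ) (x y : V) :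
    meetProb P t x y ≤ 1 := by
  induction t generalizing x y with
  | zero => rw [meetProb]; split_ifs <;> norm_num
  | succ t ih =>
    rw [meetProb]; split_ifs
    · norm_num
    · exact (pairStep_mono hP ih x y).trans_eq (pairStep_const hP 1 x y)

theorem pairStep_meetProb_le {P : V → V → ℝ} (hP : IsStoch P) (t : ℕ) (x y : V) :
    pairStep P (meetProb P t) x y ≤ meetProb P (t + 1) x y := by
  rcases eq_or_ne x y with rfl | h
  · rw [meetProb_self]
    exact (pairStep_mono hP (meetProb_le_one hP t) _ _).trans_eq (pairStep_const hP 1 _ _)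
  · rw [meetProb_succ_of_ne P t h]

theorem meetProb_mono {P : V → V → ℝ} (hP : IsStoch P) {s t : ℕ} (hst : s ≤ t) (x y : V) :
    meetProb P s x y ≤ meetProb P t x y := by
  refine monotone_nat_of_le_succ (f := fun t => meetProb P t x y) (fun t => ?_) hst
  induction t generalizing x y with
  | zero =>
    rcases eq_or_ne x y with rfl | h
    · simp only [meetProb_self, le_refl]
    · rw [meetProb_zero_of_ne P h]
      exact meetProb_nonneg hP _ _ _
  | succ t ih =>
    rcases eq_or_ne x y with rfl | h
    · simp only [meetProb_self, le_refl]
    · simp only [meetProb_succ_of_ne P _ h]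
      exact pairStep_mono hP ih x y

theorem meetProb_add_le {P : V → V → ℝ} (hP : IsStoch P) (s t : ℕ) (x y : V) :
    meetProb P (s + t) x y ≤ meetProb P s x y + (pairStep P)^[s] (meetProb P t) x y := by
  have hnn : ∀ s x y, 0 ≤ (pairStep P)^[s] (meetProb P t) x y := by
    intro s
    induction s with
    | zero => exact meetProb_nonneg hP t
    | succ s ih =>
      intro x y
      rw [Function.iterate_succ_apply']
      exact pairStep_nonneg hP ih x y
  induction s generalizing x y with
  | zero => simpa using meetProb_nonneg hP 0 x y
  | succ s ih =>
    rcases eq_or_ne x y with rfl | h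
    · simp only [meetProb_self]
      linarith [hnn (s + 1) x x]
    · rw [Nat.succ_add, meetProb_succ_of_ne P _ h, meetProb_succ_of_ne P _ h,
        Function.iterate_succ_apply', ← pairStep_add]
      exact pairStep_mono hP ih x y

/-- `π` is a stationary probability vector of `P`. -/
structure IsStationary (P : V → V → ℝ) (π : V → ℝ) : Prop where
  nonneg : ∀ v, 0 ≤ π v
  sum_eq_one : ∑ v, π v = 1
  balance : ∀ v, ∑ u, π u * P u v = π v

theorem IsStationary.sum_step {P : V → V → ℝ} {π : V → ℝ} (hπ : IsStationary P π) (g : V → ℝ) :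
    ∑ u, π u * ∑ v, P u v * g v = ∑ v, π v * g v := by
  simp only [Finset.mul_sum]
  rw [Finset.sum_comm]
  refine Finset.sum_congr rfl fun v _ => ?_
  rw [← hπ.balance v, Finset.sum_mul]
  exact Finset.sum_congr rfl fun u _ => by ring

theorem IsStationary.sum_pairStep {P : V → V → ℝ} {π : V → ℝ} (hπ : IsStationary P π)
    (g : V → V → ℝ) (x : V) :
    ∑ y, π y * pairStep P g x y = ∑ a, P x a * ∑ b, π b * g a b := by
  have h : ∀ y, π y * pairStep P g x y = ∑ a, P x a * (π y * ∑ b, P y b * g a b) := by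
    intro y
    simp only [pairStep, Finset.mul_sum]
    exact Finset.sum_congr rfl fun a _ => Finset.sum_congr rfl fun b _ => by ring
  simp only [h]
  rw [Finset.sum_comm]
  simp only [← Finset.mul_sum, hπ.sum_step]

theorem IsStationary.sum_le {P : V → V → ℝ} {π : V → ℝ} (hπ : IsStationary P π) {g h : V → ℝ}
    (hgh : ∀ v, g v ≤ h v) : ∑ v, π v * g v ≤ ∑ v, π v * h v :=
  Finset.sum_le_sum fun v _ => mul_le_mul_of_nonneg_left (hgh v) (hπ.nonneg v)

theorem IsStationary.sum_const {P : V → V → ℝ} {π : V → ℝ} (hπ : IsStationary P π) (c : ℝ) :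
    ∑ v, π v * c = c := by
  rw [← Finset.sum_mul, hπ.sum_eq_one, one_mul]

theorem IsStoch.sum_le_const {P : V → V → ℝ} (hP : IsStoch P) {g : V → ℝ} {c : ℝ} (x : V)
    (hg : ∀ v, g v ≤ c) : ∑ v, P x v * g v ≤ c := by
  calc ∑ v, P x v * g v ≤ ∑ v, P x v * c :=
        Finset.sum_le_sum fun v _ => mul_le_mul_of_nonneg_left (hg v) (hP.nonneg _ _)
    _ = c := by rw [← Finset.sum_mul, hP.sum_eq_one, one_mul]

/-- The probability that a walk from `x` meets an independent stationary walk by time `t`. -/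
noncomputable def avgMeet (P : V → V → ℝ) (π : V → ℝ) (t : ℕ) (x : V) : ℝ :=
  ∑ y, π y * meetProb P t x y

/-- The probability that two independent stationary walks meet by time `t`. -/
noncomputable def statMeet (P : V → V → ℝ) (π : V → ℝ) (t : ℕ) : ℝ :=
  ∑ x, π x * avgMeet P π t x

theorem avgMeet_mono {P : V → V → ℝ} (hP : IsStoch P) {π : V → ℝ} (hπ : IsStationary P π)
    {s t : ℕ} (hst : s ≤ t) (x : V) : avgMeet P π s x ≤ avgMeet P π t x :=
  hπ.sum_le fun y => meetProb_mono hP hst x y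

theorem avgMeet_nonneg {P : V → V → ℝ} (hP : IsStoch P) {π : V → ℝ} (hπ : IsStationary P π)
    (t : ℕ) (x : V) : 0 ≤ avgMeet P π t x :=
  Finset.sum_nonneg fun y _ => mul_nonneg (hπ.nonneg y) (meetProb_nonneg hP t x y)

theorem statMeet_nonneg {P : V → V → ℝ} (hP : IsStoch P) {π : V → ℝ} (hπ : IsStationary P π)
    (t : ℕ) : 0 ≤ statMeet P π t :=
  Finset.sum_nonneg fun y _ => mul_nonneg (hπ.nonneg y) (avgMeet_nonneg hP hπ t y)

theorem statMeet_mono {P : V → V → ℝ} (hP : IsStoch P) {π : V → ℝ} (hπ : IsStationary P π)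
    {s t : ℕ} (hst : s ≤ t) : statMeet P π s ≤ statMeet P π t :=
  hπ.sum_le fun x => avgMeet_mono hP hπ hst x

theorem sum_avgMeet_le {P : V → V → ℝ} (hP : IsStoch P) {π : V → ℝ} (hπ : IsStationary P π)
    (t : ℕ) (x : V) : ∑ a, P x a * avgMeet P π t a ≤ avgMeet P π (t + 1) x := by
  simp only [avgMeet]
  rw [← hπ.sum_pairStep]
  exact hπ.sum_le fun y => pairStep_meetProb_le hP t x y

/-- By stationarity and a union bound over the time intervals `[0, s]` and `[s, s + t]`. -/
theorem statMeet_add_le {P : V → V → ℝ} (hP : IsStoch P) {π : V → ℝ} (hπ : IsStationary P π)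
    (s t : ℕ) : statMeet P π (s + t) ≤ statMeet P π s + statMeet P π t := by
  have h : ∀ s, ∑ x, π x * ∑ y, π y * (pairStep P)^[s] (meetProb P t) x y = statMeet P π t := by
    intro s
    induction s with
    | zero => rfl
    | succ s ih =>
      simp only [Function.iterate_succ_apply', hπ.sum_pairStep, hπ.sum_step, ih]
  have h2 := hπ.sum_le fun x => hπ.sum_le fun y => meetProb_add_le hP s t x y
  simp only [mul_add, Finset.sum_add_distrib, h] at h2
  exact h2

theorem statMeet_mul_le {P : V → V → ℝ} (hP : IsStoch P) {π : V → ℝ} (hπ : IsStationary P π)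
    (t j : ℕ) : statMeet P π ((j + 1) * t) ≤ (j + 1) * statMeet P π t := by
  induction j with
  | zero => simp
  | succ j ih =>
    rw [Nat.succ_mul (j + 1)]
    push_cast
    linarith [statMeet_add_le hP hπ ((j + 1) * t) t]

/-- The probability that the walk from `x` visits `A` by time `t`. -/
noncomputable def hitProb (P : V → V → ℝ) (A : V → Prop) [DecidablePred A] : ℕ → V → ℝ
  | 0, x => if A x then 1 else 0
  | t + 1, x => if A x then 1 else ∑ a, P x a * hitProb P A t a

/-- The probability that the walk from `x` is outside `A` at some time and meets the independent
walk from `y` at the first such time or later, by time `t`; meetings before that time are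
ignored. -/
noncomputable def exitMeetProb (P : V → V → ℝ) (A : V → Prop) [DecidablePred A] :
    ℕ → V → V → ℝ
  | 0, x, y => if A x then 0 else meetProb P 0 x y
  | t + 1, x, y => if A x then pairStep P (exitMeetProb P A t) x y else meetProb P (t + 1) x y

theorem hitProb_nonneg {P : V → V → ℝ} (hP : IsStoch P) (A : V → Prop) [DecidablePred A]
    (t : ℕ) (x : V) : 0 ≤ hitProb P A t x := by
  induction t generalizing x with
  | zero => rw [hitProb]; split_ifs <;> norm_num
  | succ t ih =>
    rw [hitProb]; split_ifs
    · norm_num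
    · exact Finset.sum_nonneg fun a _ => mul_nonneg (hP.nonneg _ _) (ih a)

theorem exitMeetProb_nonneg {P : V → V → ℝ} (hP : IsStoch P) (A : V → Prop) [DecidablePred A]
    (t : ℕ) (x y : V) : 0 ≤ exitMeetProb P A t x y := by
  induction t generalizing x y with
  | zero =>
    rw [exitMeetProb]; split_ifs
    · norm_num
    · exact meetProb_nonneg hP _ _ _
  | succ t ih =>
    rw [exitMeetProb]; split_ifs
    · exact pairStep_nonneg hP ih x y
    · exact meetProb_nonneg hP _ _ _

theorem sum_hitProb_le {P : V → V → ℝ} (hP : IsStoch P) (A : V → Prop) [DecidablePred A]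
    (t : ℕ) (x : V) : ∑ a, P x a * hitProb P A t a ≤ hitProb P A (t + 1) x := by
  have hle : ∀ t x, hitProb P A t x ≤ 1 := by
    intro t
    induction t with
    | zero => intro x; rw [hitProb]; split_ifs <;> norm_num
    | succ t ih =>
      intro x; rw [hitProb]; split_ifs
      · norm_num
      · exact hP.sum_le_const x ih
  rw [hitProb]; split_ifs
  · exact hP.sum_le_const x (hle t)
  · exact le_rfl

/-- If the walks from `x` and `y` meet while the first one is still in `A`, then the second one
visits `A`. -/
theorem meetProb_le_hitProb_add {P : V → V → ℝ} (hP : IsStoch P) (A : V → Prop)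
    [DecidablePred A] (t : ℕ) (x y : V) :
    meetProb P t x y ≤ hitProb P A t y + exitMeetProb P A t x y := by
  induction t generalizing x y with
  | zero =>
    by_cases hA : A x
    · rcases eq_or_ne x y with rfl | h
      · simp [meetProb, hitProb, exitMeetProb, hA]
      · rw [meetProb_zero_of_ne P h]
        exact add_nonneg (hitProb_nonneg hP A _ _) (exitMeetProb_nonneg hP A _ _ _)
    · simp only [exitMeetProb, if_neg hA, le_add_iff_nonneg_left, hitProb_nonneg hP]
  | succ t ih =>
    by_cases hA : A x
    · rcases eq_or_ne x y with rfl | h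
      · rw [meetProb_self, hitProb, if_pos hA, le_add_iff_nonneg_right]
        exact exitMeetProb_nonneg hP A _ _ _
      · rw [meetProb_succ_of_ne P t h, exitMeetProb, if_pos hA]
        refine (pairStep_mono hP ih x y).trans ?_
        rw [pairStep_add, pairStep_snd hP]
        linarith [sum_hitProb_le hP A t y]
    · simp only [exitMeetProb, if_neg hA, le_add_iff_nonneg_left, hitProb_nonneg hP]

/-- Markov property at the first visit to the set of vertices from which a walk meets a stationary
walk within `T` steps with probability at least `θ`. -/
theorem mul_hitProb_le {P : V → V → ℝ} (hP : IsStoch P) {π : V → ℝ} (hπ : IsStationary P π)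
    (T : ℕ) {θ : ℝ} (t : ℕ) (x : V) :
    θ * hitProb P (fun v => θ ≤ avgMeet P π T v) t x ≤ avgMeet P π (T + t) x := by
  induction t generalizing x with
  | zero =>
    rw [hitProb]; split_ifs with h
    · simpa using h
    · simpa using avgMeet_nonneg hP hπ T x
  | succ t ih =>
    rw [hitProb]; split_ifs with h
    · rw [mul_one]
      exact h.trans (avgMeet_mono hP hπ (Nat.le_add_right _ _) x)
    · refine le_trans ?_ (sum_avgMeet_le hP hπ (T + t) x)
      rw [Finset.mul_sum]
      refine Finset.sum_le_sum fun a _ => ?_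
      rw [mul_left_comm]
      exact mul_le_mul_of_nonneg_left (ih a) (hP.nonneg _ _)

theorem sum_exitMeetProb_le {P : V → V → ℝ} (hP : IsStoch P) {π : V → ℝ}
    (hπ : IsStationary P π) (T : ℕ) {θ : ℝ} (hθ : 0 ≤ θ) {t : ℕ} (ht : t ≤ T) (x : V) :
    ∑ y, π y * exitMeetProb P (fun v => θ ≤ avgMeet P π T v) t x y ≤ θ := by
  induction t generalizing x with
  | zero =>
    simp only [exitMeetProb]; split_ifs with h
    · simpa using hθ
    · exact (avgMeet_mono hP hπ ht x).trans (not_le.1 h).le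
  | succ t ih =>
    simp only [exitMeetProb]; split_ifs with h
    · rw [hπ.sum_pairStep]
      exact hP.sum_le_const x fun a => ih (Nat.le_of_succ_le ht) a
    · exact (avgMeet_mono hP hπ ht x).trans (not_le.1 h).le

/-- No starting vertex meets a stationary walk with probability much larger than the square root
of the probability for a stationary start: with `θ = √(statMeet P π T)`, a walk that meets the
stationary walk does so either after it has left `A = {v | θ ≤ avgMeet P π T v}`, which has
probability at most `θ`, or inside `A`, and then the stationary walk visits `A`. Visiting `A` makes
it likely to meet another stationary walk, so this has probability at most
`statMeet P π (2 * T) / θ`. -/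
theorem avgMeet_le {P : V → V → ℝ} (hP : IsStoch P) {π : V → ℝ} (hπ : IsStationary P π)
    {T : ℕ} (hpos : 0 < statMeet P π T) (x : V) :
    avgMeet P π T x ≤ 3 * √(statMeet P π T) := by
  set p := statMeet P π T with hp
  have hθ : 0 < √p := Real.sqrt_pos.2 hpos
  have hsq : √p * √p = p := Real.mul_self_sqrt hpos.le
  have h1 : avgMeet P π T x ≤ ∑ y, π y * hitProb P (fun v => √p ≤ avgMeet P π T v) T y + √p := by
    have := hπ.sum_le fun y => meetProb_le_hitProb_add hP (fun v => √p ≤ avgMeet P π T v) T x y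
    simp only [mul_add, Finset.sum_add_distrib] at this
    exact this.trans (add_le_add_right (sum_exitMeetProb_le hP hπ T hθ.le le_rfl x) _)
  have h2 : √p * ∑ y, π y * hitProb P (fun v => √p ≤ avgMeet P π T v) T y ≤ 2 * p := by
    have := hπ.sum_le fun y => mul_hitProb_le hP hπ T (θ := √p) T y
    simp only [mul_left_comm _ (√p), ← Finset.mul_sum] at this
    have h3 : statMeet P π (T + T) ≤ p + p := statMeet_add_le hP hπ T T
    simp only [statMeet] at h3
    linarith
  have h3 : ∑ y, π y * hitProb P (fun v => √p ≤ avgMeet P π T v) T y ≤ 2 * √p := by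
    refine le_of_mul_le_mul_left ?_ hθ
    linarith
  linarith

end Meeting

/-! ### Triple collisions and a counting inequality -/

section Triples

variable {V : Type*} [Fintype V] [DecidableEq V]

theorem flowExp_eq_meetProb {P : V → V → ℝ} (hP : IsStoch P) (t : ℕ) (x y : V) :
    flowExp P t (fun g => if g x = g y then 1 else 0) = meetProb P t x y := by
  induction t generalizing x y with
  | zero => rfl
  | succ t ih =>
    rcases eq_or_ne x y with rfl | h
    · simp only [if_true, flowExp_const hP, meetProb_self]
    · simp only [flowExp, Function.comp, ih]
      rw [indepExp_pair hP h (meetProb P t), meetProb_succ_of_ne P t h, pairStep]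

/-- The probability that the walks from `x` and `y` meet, that the walk from `z` meets neither of
them at an earlier time, and that it meets the merged walk at that time or later, by time `t`. -/
noncomputable def pairFirstProb (P : V → V → ℝ) : ℕ → V → V → V → ℝ
  | 0, x, y, z => if x = y then meetProb P 0 x z else 0
  | t + 1, x, y, z =>
    if x = y then meetProb P (t + 1) x z
    else if z = x ∨ z = y then 0
    else indepExp P fun f => pairFirstProb P t (f x) (f y) (f z)

theorem pairFirstProb_nonneg {P : V → V → ℝ} (hP : IsStoch P) (t : ℕ) (x y z : V) :
    0 ≤ pairFirstProb P t x y z := by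
  induction t generalizing x y z with
  | zero =>
    rw [pairFirstProb]; split_ifs
    · exact meetProb_nonneg hP _ _ _
    · exact le_rfl
  | succ t ih =>
    rw [pairFirstProb]; split_ifs
    · exact meetProb_nonneg hP _ _ _
    · exact le_rfl
    · exact (indepExp_const hP 0).symm.le.trans (indepExp_mono hP fun f => ih _ _ _)

theorem pairFirstProb_self (P : V → V → ℝ) (t : ℕ) (x z : V) :
    pairFirstProb P t x x z = meetProb P t x z := by
  cases t <;> simp [pairFirstProb]

/-- If three coalescing walks merge, then some two of them meet first. -/
theorem flowExp_triple_le {P : V → V → ℝ} (hP : IsStoch P) (t : ℕ) (x y z : V) :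
    flowExp P t (fun g => if g x = g y ∧ g x = g z then 1 else 0) ≤
      pairFirstProb P t x y z + pairFirstProb P t x z y + pairFirstProb P t y z x := by
  have hxy : ∀ t x z, flowExp P t (fun g => if g x = g x ∧ g x = g z then 1 else 0) ≤
      pairFirstProb P t x x z + pairFirstProb P t x z x + pairFirstProb P t x z x := by
    intro t x z
    simp only [true_and, flowExp_eq_meetProb hP, pairFirstProb_self]
    linarith [pairFirstProb_nonneg hP t x z x]
  have hxz : ∀ t x y, flowExp P t (fun g => if g x = g y ∧ g x = g x then 1 else 0) ≤
      pairFirstProb P t x y x + pairFirstProb P t x x y + pairFirstProb P t y x x := by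
    intro t x y
    simp only [and_true, flowExp_eq_meetProb hP, pairFirstProb_self]
    linarith [pairFirstProb_nonneg hP t x y x, pairFirstProb_nonneg hP t y x x]
  have hyz : ∀ t x y, flowExp P t (fun g => if g x = g y ∧ g x = g y then 1 else 0) ≤
      pairFirstProb P t x y y + pairFirstProb P t x y y + pairFirstProb P t y y x := by
    intro t x y
    simp only [and_self, flowExp_eq_meetProb hP, pairFirstProb_self, meetProb_symm P t y x]
    linarith [pairFirstProb_nonneg hP t x y y]
  induction t generalizing x y z with
  | zero =>
    rcases eq_or_ne x y with rfl | h1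
    · exact hxy 0 x z
    · simp only [flowExp, id, h1, false_and, if_false]
      have := pairFirstProb_nonneg hP 0
      linarith [this x y z, this x z y, this y z x]
  | succ t ih =>
    rcases eq_or_ne x y with rfl | h1
    · exact hxy _ x z
    rcases eq_or_ne x z with rfl | h2
    · exact hxz _ x y
    rcases eq_or_ne y z with rfl | h3
    · exact hyz _ x y
    simp only [pairFirstProb, h1, h2, h3, h1.symm, h2.symm, h3.symm, or_self,
      if_false, flowExp, Function.comp]
    rw [← indepExp_add, ← indepExp_add]
    exact indepExp_mono hP fun f => ih _ _ _

theorem sum_pairFirstProb_le {P : V → V → ℝ} (hP : IsStoch P) {π : V → ℝ}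
    (hπ : IsStationary P π) {T : ℕ} {κ : ℝ} (hκ : ∀ v, avgMeet P π T v ≤ κ) {t : ℕ} (ht : t ≤ T)
    (x y : V) : ∑ z, π z * pairFirstProb P t x y z ≤ κ * meetProb P t x y := by
  induction t generalizing x y with
  | zero =>
    rcases eq_or_ne x y with rfl | h
    · simp only [pairFirstProb_self, meetProb_self, mul_one]
      exact (avgMeet_mono hP hπ ht x).trans (hκ x)
    · simp [pairFirstProb, meetProb, h]
  | succ t ih =>
    rcases eq_or_ne x y with rfl | h
    · simp only [pairFirstProb_self, meetProb_self, mul_one]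
      exact (avgMeet_mono hP hπ ht x).trans (hκ x)
    · rw [meetProb_succ_of_ne P t h, ← pairStep_const_mul]
      refine le_trans ?_ (pairStep_mono hP (fun a b => ih (Nat.le_of_succ_le ht) a b) x y)
      have h1 : ∀ z, pairFirstProb P (t + 1) x y z ≤
          pairStep P (fun a b => ∑ c, P z c * pairFirstProb P t a b c) x y := by
        intro z
        have hnn : 0 ≤ pairStep P (fun a b => ∑ c, P z c * pairFirstProb P t a b c) x y :=
          pairStep_nonneg hP (fun a b => Finset.sum_nonneg fun c _ =>
            mul_nonneg (hP.nonneg _ _) (pairFirstProb_nonneg hP _ _ _ _)) x y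
        rw [pairFirstProb, if_neg h]
        split_ifs with hz
        · exact hnn
        · push Not at hz
          rw [indepExp_triple hP h hz.1.symm hz.2.symm (pairFirstProb P t), pairStep]
          simp only [Finset.mul_sum, mul_assoc, le_refl]
      refine (hπ.sum_le h1).trans_eq ?_
      simp only [← hπ.sum_step (fun c => pairFirstProb P t _ _ c)]
      simp only [pairStep, Finset.mul_sum]
      rw [Finset.sum_comm]
      refine Finset.sum_congr rfl fun a _ => ?_
      rw [Finset.sum_comm]
      refine Finset.sum_congr rfl fun b _ => Finset.sum_congr rfl fun z _ =>
        Finset.sum_congr rfl fun c _ => ?_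
      ring

/-- Three stationary coalescing walks merge by time `T` with probability at most `3 * κ` times that
of a pair, if `κ` bounds the probability to meet a stationary walk from any vertex. -/
theorem sum_flowExp_triple_le {P : V → V → ℝ} (hP : IsStoch P) {π : V → ℝ}
    (hπ : IsStationary P π) {T : ℕ} {κ : ℝ} (hκ : ∀ v, avgMeet P π T v ≤ κ) :
    ∑ x, ∑ y, ∑ z, π x * π y * π z *
      flowExp P T (fun g => if g x = g y ∧ g x = g z then 1 else 0) ≤
      3 * κ * statMeet P π T := by
  have h1 : ∑ x, ∑ y, ∑ z, π x * π y * π z * pairFirstProb P T x y z ≤ κ * statMeet P π T := by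
    have := hπ.sum_le fun x => hπ.sum_le fun y => sum_pairFirstProb_le hP hπ hκ le_rfl x y
    simp only [mul_left_comm _ κ, ← Finset.mul_sum] at this
    refine le_trans (le_of_eq ?_) this
    simp only [Finset.mul_sum, mul_assoc]
  have h2 : ∑ x, ∑ y, ∑ z, π x * π y * π z * pairFirstProb P T x z y =
      ∑ x, ∑ y, ∑ z, π x * π y * π z * pairFirstProb P T x y z := by
    refine Finset.sum_congr rfl fun x _ => ?_
    rw [Finset.sum_comm]
    exact Finset.sum_congr rfl fun y _ => Finset.sum_congr rfl fun z _ => by ring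
  have h3 : ∑ x, ∑ y, ∑ z, π x * π y * π z * pairFirstProb P T y z x =
      ∑ x, ∑ y, ∑ z, π x * π y * π z * pairFirstProb P T x y z := by
    rw [Finset.sum_comm]
    refine Finset.sum_congr rfl fun x _ => ?_
    rw [Finset.sum_comm]
    exact Finset.sum_congr rfl fun y _ => Finset.sum_congr rfl fun z _ => by ring
  calc _ ≤ ∑ x, ∑ y, ∑ z, π x * π y * π z * (pairFirstProb P T x y z +
        pairFirstProb P T x z y + pairFirstProb P T y z x) :=
        Finset.sum_le_sum fun x _ => Finset.sum_le_sum fun y _ => Finset.sum_le_sum fun z _ =>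
          mul_le_mul_of_nonneg_left (flowExp_triple_le hP T x y z)
            (mul_nonneg (mul_nonneg (hπ.nonneg x) (hπ.nonneg y)) (hπ.nonneg z))
    _ ≤ _ := by
        simp only [mul_add, Finset.sum_add_distrib]
        linarith

end Triples

section Counting

variable {α β : Type*} [DecidableEq α] [DecidableEq β]

/-- The number of indices lost under `y` is at least the number of colliding pairs, corrected by
colliding triples: a fibre of size `c` loses `c - 1`, and
`c * (c - 1) * (3 - c) ≤ 2 * (c - 1)`. -/
theorem sum_pairs_sub_triples_le (R : Finset α) (y : α → β) :
    ∑ i ∈ R, ∑ j ∈ R.erase i, ((if y i = y j then (1 : ℝ) else 0) -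
      ∑ l ∈ (R.erase i).erase j, if y i = y j ∧ y i = y l then (1 : ℝ) else 0) ≤
      2 * ((R.card : ℝ) - (R.image y).card) := by
  set c : β → ℕ := fun b => (R.filter fun a => y a = b).card with hc
  have h1 : ∑ i ∈ R, (1 / (c (y i) : ℝ)) = (R.image y).card := by
    rw [Finset.sum_comp (fun b => 1 / (c b : ℝ)) y, Finset.card_eq_sum_ones, Nat.cast_sum]
    refine Finset.sum_congr rfl fun b hb => ?_
    obtain ⟨a, ha, rfl⟩ := Finset.mem_image.1 hb
    have : (c (y a) : ℝ) ≠ 0 := by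
      simp only [hc, ne_eq, Nat.cast_eq_zero, Finset.card_eq_zero]
      exact Finset.ne_empty_of_mem (Finset.mem_filter.2 ⟨ha, rfl⟩)
    simp only [nsmul_eq_mul, Nat.cast_one]
    exact mul_one_div_cancel this
  have h2 : 2 * ((R.card : ℝ) - (R.image y).card) =
      ∑ i ∈ R, 2 * (1 - 1 / (c (y i) : ℝ)) := by
    rw [← Finset.mul_sum, Finset.sum_sub_distrib, h1]
    simp
  rw [h2]
  refine Finset.sum_le_sum fun i hi => ?_
  have hcount : ∀ s : Finset α, ∑ l ∈ s, (if y i = y l then (1 : ℝ) else 0) =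
      (s.filter fun a => y a = y i).card := by
    intro s
    rw [Finset.sum_boole]
    simp only [eq_comm]
  have hcpos : 1 ≤ c (y i) := Finset.card_pos.2 ⟨i, Finset.mem_filter.2 ⟨hi, rfl⟩⟩
  have hi' : i ∈ R.filter fun a => y a = y i := Finset.mem_filter.2 ⟨hi, rfl⟩
  have he1 : (((R.erase i).filter fun a => y a = y i).card : ℝ) = c (y i) - 1 := by
    rw [Finset.filter_erase, Finset.card_erase_of_mem hi',
      Nat.cast_sub hcpos, Nat.cast_one]
  have h3 : ∀ j ∈ R.erase i, ((if y i = y j then (1 : ℝ) else 0) -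
      ∑ l ∈ (R.erase i).erase j, if y i = y j ∧ y i = y l then (1 : ℝ) else 0) =
      (if y i = y j then (1 : ℝ) else 0) * (3 - c (y i)) := by
    intro j hj
    by_cases h : y i = y j
    · have hj' : j ∈ (R.erase i).filter fun a => y a = y i :=
        Finset.mem_filter.2 ⟨hj, h.symm⟩
      simp only [h, true_and, if_true]
      rw [← h, hcount, Finset.filter_erase, Finset.card_erase_of_mem hj',
        Nat.cast_sub (Finset.card_pos.2 ⟨j, hj'⟩), he1]
      push_cast
      ring
    · simp [h]
  rw [Finset.sum_congr rfl h3, ← Finset.sum_mul, hcount, he1]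
  obtain ⟨k, hk⟩ : ∃ k, c (y i) = k + 1 := ⟨c (y i) - 1, by omega⟩
  rw [hk]
  push_cast
  have hk0 : (0 : ℝ) < k + 1 := by positivity
  have h4 : 2 * (1 - 1 / ((k : ℝ) + 1)) = 2 * k / (k + 1) := by
    field_simp
    ring
  rw [h4, le_div_iff₀ hk0]
  rcases k with _ | k
  · simp
  · push_cast
    have : (0 : ℝ) ≤ k := Nat.cast_nonneg k
    nlinarith [mul_nonneg this this, mul_nonneg this (mul_nonneg this this)]

theorem card_sub_card_image_mono {R A : Finset α} (h : R ⊆ A) (y : α → β) :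
    (R.card : ℝ) - (R.image y).card ≤ (A.card : ℝ) - (A.image y).card := by
  have h1 : (A.image y).card ≤ (R.image y).card + (A \ R).card := by
    calc (A.image y).card = ((R ∪ A \ R).image y).card := by rw [Finset.union_sdiff_of_subset h]
      _ ≤ _ := by
        rw [Finset.image_union]
        exact (Finset.card_union_le _ _).trans (Nat.add_le_add_left Finset.card_image_le _)
  have h2 := Finset.card_sdiff_add_card_eq_card h
  have h1' : ((A.image y).card : ℝ) ≤ (R.image y).card + (A \ R).card := by exact_mod_cast h1
  have h2' : ((A \ R).card : ℝ) + R.card = A.card := by exact_mod_cast h2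
  linarith

end Counting

/-! ### The expected loss of particles over a block of time -/

section Loss

variable {V : Type*} [Fintype V] [DecidableEq V]

/-- The expected number of particles of `A` lost by time `T`, if the particles start at
independent positions, that of `v` with the law `q v`, and then perform coalescing walks. -/
noncomputable def loss (P q : V → V → ℝ) (T : ℕ) (A : Finset V) : ℝ :=
  indepExp q fun z => flowExp P T fun g => (A.card : ℝ) - (A.image (g ∘ z)).card

theorem le_loss_of_forall {P q : V → V → ℝ} (hP : IsStoch P) (hq : IsStoch q) (T : ℕ) {φ : ℝ}
    {A : Finset V} (h : ∀ y : V → V, φ ≤ (A.card : ℝ) - (A.image y).card) : φ ≤ loss P q T A := by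
  have h1 : indepExp q (fun _ => flowExp P T fun _ => φ) = φ := by
    simp only [flowExp_const hP, indepExp_const hq]
  exact h1.symm.le.trans (indepExp_mono hq fun z => flowExp_mono hP T fun g => h _)

theorem loss_nonneg {P q : V → V → ℝ} (hP : IsStoch P) (hq : IsStoch q) (T : ℕ)
    (A : Finset V) : 0 ≤ loss P q T A :=
  le_loss_of_forall hP hq T fun y => sub_nonneg.2 (by exact_mod_cast Finset.card_image_le)

theorem loss_add_loss_sdiff_le {P q : V → V → ℝ} (hP : IsStoch P) (hq : IsStoch q) (T : ℕ)
    {A S : Finset V} (h : A ⊆ S) : loss P q T A + loss P q T (S \ A) ≤ loss P q T S := by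
  rw [loss, loss, ← indepExp_add]
  refine indepExp_mono hq fun z => ?_
  rw [← sub_neg_eq_add]
  have hneg : ∀ B : Finset V, -flowExp P T (fun g => (B.card : ℝ) - (B.image (g ∘ z)).card) =
      flowExp P T (fun g => (-1) * ((B.card : ℝ) - (B.image (g ∘ z)).card)) := by
    intro B
    rw [flowExp_const_mul]
    ring
  rw [hneg, ← flowExp_sub]
  refine flowExp_mono hP T fun g => ?_
  have h1 : (S.image (g ∘ z)).card ≤ (A.image (g ∘ z)).card + ((S \ A).image (g ∘ z)).card := by
    calc (S.image (g ∘ z)).card = ((A ∪ S \ A).image (g ∘ z)).card := by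
          rw [Finset.union_sdiff_of_subset h]
      _ ≤ _ := by
        rw [Finset.image_union]
        exact Finset.card_union_le _ _
  have h2 := Finset.card_sdiff_add_card_eq_card h
  have h1' : ((S.image (g ∘ z)).card : ℝ) ≤
    (A.image (g ∘ z)).card + ((S \ A).image (g ∘ z)).card := by exact_mod_cast h1
  have h2' : ((S \ A).card : ℝ) + A.card = S.card := by exact_mod_cast h2
  linarith

/-- Disjoint groups of size `m` contribute separately to the loss. -/
theorem mul_le_loss {P q : V → V → ℝ} (hP : IsStoch P) (hq : IsStoch q) (T : ℕ) {m : ℕ}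
    {b : ℝ} (hb : ∀ A : Finset V, A.card = m → b ≤ loss P q T A) (j : ℕ) (S : Finset V)
    (hS : j * m ≤ S.card) : j * b ≤ loss P q T S := by
  induction j generalizing S with
  | zero => simpa using loss_nonneg hP hq T S
  | succ j ih =>
    rw [Nat.succ_mul] at hS
    obtain ⟨A, hAS, hA⟩ := Finset.exists_subset_card_eq (le_trans (Nat.le_add_left _ _) hS)
    have h1 := loss_add_loss_sdiff_le hP hq T hAS
    have h2 := ih (S \ A) (by rw [Finset.card_sdiff_of_subset hAS]; omega)
    have h3 := hb A hA
    push_cast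
    linarith

/-- A lower bound for the loss of a group that is so small that triple collisions are rare. Each
particle is, with probability `δ`, at a stationary position; only these particles are counted, and
`sum_pairs_sub_triples_le` is applied to them. -/
theorem group_loss_ge {P q : V → V → ℝ} (hP : IsStoch P) (hq : IsStoch q) {π : V → ℝ}
    (hπ : IsStationary P π) {T : ℕ} {κ : ℝ} (hκ : ∀ v, avgMeet P π T v ≤ κ) {δ : ℝ} (hδ : 0 ≤ δ)
    (hmin : ∀ v x, δ * π x ≤ q v x) (A : Finset V)
    (hA : ((A.card : ℝ) - 2) * (3 * δ * κ) ≤ 1 / 2) :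
    (A.card : ℝ) * (A.card - 1) * (δ ^ 2 * statMeet P π T / 4) ≤ loss P q T A := by
  set p := statMeet P π T with hp
  have hp0 : 0 ≤ p := statMeet_nonneg hP hπ T
  -- the marked law: the mark `true` stands for a position drawn from `π`
  let q' : V → V × Bool → ℝ := fun v x => if x.2 then δ * π x.1 else q v x.1 - δ * π x.1
  have hq' : IsStoch q' := by
    refine ⟨fun v x => ?_, fun v => ?_⟩
    · simp only [q']
      split_ifs
      · exact mul_nonneg hδ (hπ.nonneg _)
      · exact sub_nonneg.2 (hmin _ _)
    · rw [Fintype.sum_prod_type]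
      simp [q', hq.sum_eq_one]
  have hmap : ∀ ψ : (V → V) → ℝ, indepExp q ψ = indepExp q' fun z => ψ fun v => (z v).1 := by
    intro ψ
    rw [indepExp_map q' Prod.fst ψ]
    congr 1
    ext v c
    rw [Fintype.sum_prod_type]
    simp only [Fintype.sum_bool, ← add_mul]
    simp [q']
  let r : V × Bool → ℝ := fun x => if x.2 then 1 else 0
  let M : V → V → V → ℝ := fun x y z =>
    flowExp P T (fun g => if g x = g y ∧ g x = g z then 1 else 0)
  have hM : ∑ x, ∑ y, ∑ z, π x * π y * π z * M x y z ≤ 3 * κ * p :=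
    sum_flowExp_triple_le hP hπ hκ
  have hM0 : ∀ x y z, 0 ≤ M x y z := fun x y z =>
    flowExp_nonneg hP T fun g => by split_ifs <;> norm_num
  -- the pointwise bound
  have hpt : ∀ z : V → V × Bool, ∑ i ∈ A, ∑ j ∈ A.erase i,
      (r (z i) * r (z j) * meetProb P T (z i).1 (z j).1 - ∑ l ∈ (A.erase i).erase j,
        r (z i) * r (z j) * r (z l) * M (z i).1 (z j).1 (z l).1) ≤
      2 * flowExp P T fun g => (A.card : ℝ) - (A.image (g ∘ fun v => (z v).1)).card := by
    intro z
    have hflow : ∑ i ∈ A, ∑ j ∈ A.erase i,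
        (r (z i) * r (z j) * meetProb P T (z i).1 (z j).1 - ∑ l ∈ (A.erase i).erase j,
          r (z i) * r (z j) * r (z l) * M (z i).1 (z j).1 (z l).1) =
        flowExp P T fun g => ∑ i ∈ A, ∑ j ∈ A.erase i,
          (r (z i) * r (z j) * (if g (z i).1 = g (z j).1 then 1 else 0) -
            ∑ l ∈ (A.erase i).erase j, r (z i) * r (z j) * r (z l) *
              if g (z i).1 = g (z j).1 ∧ g (z i).1 = g (z l).1 then 1 else 0) := by
      simp only [flowExp_sum, flowExp_sub, flowExp_const_mul, flowExp_eq_meetProb hP, M]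
    rw [hflow, ← flowExp_const_mul]
    refine flowExp_mono hP T fun g => ?_
    set R := A.filter fun v => (z v).2 = true with hR
    have h1 := sum_pairs_sub_triples_le R (g ∘ fun v => (z v).1)
    have h2 := card_sub_card_image_mono (Finset.filter_subset _ _ : R ⊆ A)
      (g ∘ fun v => (z v).1)
    refine le_trans (le_of_eq ?_) (h1.trans (mul_le_mul_of_nonneg_left h2 zero_le_two))
    simp only [hR, ← Finset.filter_erase, Finset.sum_filter, r, Function.comp]
    refine Finset.sum_congr rfl fun i _ => ?_
    by_cases hi : (z i).2 = true
    · simp only [hi, if_true, one_mul]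
      refine Finset.sum_congr rfl fun j _ => ?_
      by_cases hj : (z j).2 = true
      · simp only [hj, if_true, one_mul, ite_mul, zero_mul]
      · simp [hj]
    · simp [hi]
  have hmarg2 : ∀ i j, i ≠ j → indepExp q' (fun z => r (z i) * r (z j) *
      meetProb P T (z i).1 (z j).1) = δ ^ 2 * p := by
    intro i j hij
    rw [indepExp_pair hq' hij fun a b => r a * r b * meetProb P T a.1 b.1]
    simp only [Fintype.sum_prod_type, Fintype.sum_bool, q', r]
    simp only [if_true, Bool.false_eq_true, if_false, mul_zero, zero_mul, add_zero, one_mul,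
      hp, statMeet, avgMeet, Finset.mul_sum, Finset.sum_const_zero]
    exact Finset.sum_congr rfl fun a _ => Finset.sum_congr rfl fun b _ => by ring
  have hmarg3 : ∀ i j l, i ≠ j → i ≠ l → j ≠ l → indepExp q' (fun z => r (z i) * r (z j) *
      r (z l) * M (z i).1 (z j).1 (z l).1) ≤ δ ^ 3 * (3 * κ * p) := by
    intro i j l hij hil hjl
    rw [indepExp_triple hq' hij hil hjl fun a b c => r a * r b * r c * M a.1 b.1 c.1]
    refine le_trans (le_of_eq ?_) (mul_le_mul_of_nonneg_left hM (pow_nonneg hδ 3))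
    simp only [Fintype.sum_prod_type, Fintype.sum_bool, q', r]
    simp only [if_true, Bool.false_eq_true, if_false, mul_zero, zero_mul, add_zero, one_mul,
      Finset.mul_sum, Finset.sum_const_zero]
    exact Finset.sum_congr rfl fun a _ => Finset.sum_congr rfl fun b _ =>
      Finset.sum_congr rfl fun c _ => by ring
  have hexp := indepExp_mono hq' hpt
  rw [indepExp_const_mul, ← hmap fun z => flowExp P T fun g =>
    (A.card : ℝ) - (A.image (g ∘ z)).card, ← loss] at hexp
  simp only [indepExp_sum, indepExp_sub] at hexp
  have hlow : ∑ i ∈ A, ∑ j ∈ A.erase i, (δ ^ 2 * p / 2) ≤ 2 * loss P q T A := by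
    refine le_trans (Finset.sum_le_sum fun i hi => Finset.sum_le_sum fun j hj => ?_) hexp
    have hij : i ≠ j := (Finset.ne_of_mem_erase hj).symm
    rw [hmarg2 i j hij]
    have h1 : ∑ l ∈ (A.erase i).erase j, indepExp q' (fun z => r (z i) * r (z j) *
        r (z l) * M (z i).1 (z j).1 (z l).1) ≤ ∑ l ∈ (A.erase i).erase j, δ ^ 3 * (3 * κ * p) := by
      refine Finset.sum_le_sum fun l hl => hmarg3 i j l hij ?_ ?_
      · exact (Finset.ne_of_mem_erase (Finset.mem_of_mem_erase hl)).symm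
      · exact (Finset.ne_of_mem_erase hl).symm
    have hc : (((A.erase i).erase j).card : ℝ) = A.card - 2 := by
      have e1 := Finset.card_erase_add_one hj
      have e2 := Finset.card_erase_add_one hi
      have e3 : (((A.erase i).erase j).card : ℝ) + 1 + 1 = A.card := by
        rw [← e2, ← e1]; push_cast; ring
      linarith
    rw [Finset.sum_const, nsmul_eq_mul, hc] at h1
    have h2 := mul_le_mul_of_nonneg_right hA (mul_nonneg (pow_nonneg hδ 2) hp0)
    linarith
  have hcard : ∀ i ∈ A, ((A.erase i).card : ℝ) = A.card - 1 := by
    intro i hi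
    have := Finset.card_erase_add_one hi
    have : ((A.erase i).card : ℝ) + 1 = A.card := by exact_mod_cast this
    linarith
  have hsum : ∑ i ∈ A, ∑ j ∈ A.erase i, (δ ^ 2 * p / 2) =
      (A.card : ℝ) * ((A.card - 1) * (δ ^ 2 * p / 2)) := by
    rw [Finset.sum_congr rfl fun i hi => by rw [Finset.sum_const, nsmul_eq_mul, hcard i hi],
      Finset.sum_const, nsmul_eq_mul]
  linarith

end Loss

section Decoupling

variable {V : Type*} [Fintype V] [DecidableEq V]

/-- Particles that share a vertex and move together occupy fewer vertices than particles that
move independently. -/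
theorem indepExp_image_image_le {q : V → V → ℝ} (hq : IsStoch q) (y : V → V) (S : Finset V)
    {ψ : Finset V → ℝ} (hψ : Monotone ψ) :
    indepExp q (fun z => ψ ((S.image y).image z)) ≤
      indepExp (fun v => q (y v)) fun z => ψ (S.image z) := by
  have hex : ∀ w : ↥(S.image y), ∃ v ∈ S, y v = w := fun w => Finset.mem_image.1 w.2
  choose r hrS hr using hex
  have hinj : Function.Injective r := fun a b hab =>
    Subtype.ext (by rw [← hr a, ← hr b, hab])
  have h1 : ∀ z : V → V, (S.image y).image z =
      Finset.univ.image (z ∘ (Subtype.val : ↥(S.image y) → V)) := by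
    intro z
    ext a
    simp
  have hqy : IsStoch fun v => q (y v) := ⟨fun v => hq.nonneg _, fun v => hq.sum_eq_one _⟩
  simp only [h1]
  rw [indepExp_comp_injective hq Subtype.val_injective fun x => ψ (Finset.univ.image x)]
  have h2 := indepExp_comp_injective hqy hinj fun x => ψ (Finset.univ.image x)
  simp only [hr] at h2
  rw [← h2]
  refine indepExp_mono hqy fun z => hψ ?_
  intro a ha
  obtain ⟨w, -, rfl⟩ := Finset.mem_image.1 ha
  exact Finset.mem_image_of_mem z (hrS w)

/-- Ignoring the collisions of the first `s` steps leaves more particles. -/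
theorem flowExp_image_le {P : V → V → ℝ} (hP : IsStoch P) (s : ℕ) (S : Finset V)
    {ψ : Finset V → ℝ} (hψ : Monotone ψ) :
    flowExp P s (fun f => ψ (S.image f)) ≤
      indepExp (stepPow P s) fun z => ψ (S.image z) := by
  induction s generalizing S with
  | zero => exact (indepExp_dirac (fun v => v) fun z => ψ (S.image z)).symm.le
  | succ s ih =>
    have h : (indepExp P fun f => indepExp (fun v => stepPow P s (f v)) fun z => ψ (S.image z)) =
        indepExp (stepPow P (s + 1)) fun z => ψ (S.image z) :=
      indepExp_bind P (stepPow P s) _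
    rw [← h]
    refine indepExp_mono hP fun f => ?_
    simp only [← Finset.image_image]
    exact (ih _).trans (indepExp_image_image_le (isStoch_stepPow hP s) f S hψ)

theorem loss_stepPow_le {P : V → V → ℝ} (hP : IsStoch P) (s T : ℕ) (S : Finset V) :
    loss P (stepPow P s) T S ≤ S.card - flowExp P (s + T) fun g => ((S.image g).card : ℝ) := by
  have h1 := flowExp_image_le hP s S (ψ := fun U => flowExp P T fun g => ((U.image g).card : ℝ))
    (fun U U' h => flowExp_mono hP T fun g => by
      exact_mod_cast Finset.card_le_card (Finset.image_subset_image h))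
  rw [flowExp_add_time]
  simp only [Finset.image_image] at h1
  rw [loss]
  simp only [flowExp_sub, indepExp_sub, flowExp_const hP, indepExp_const (isStoch_stepPow hP s)]
  linarith

end Decoupling

section Drift

variable {V : Type*} [Fintype V] [DecidableEq V]

/-- A drift criterion: if a function `Φ` of the number of particles decreases in mean by `c` over a
block of `B` steps, then the expected number of steps before only one particle is left is at most
`B / c * Φ`. -/
theorem sum_card_ne_one_le {P : V → V → ℝ} (hP : IsStoch P) {B : ℕ} (hB : 1 ≤ B) {Φ : ℕ → ℝ}
    {c : ℝ} (hc : 0 < c) (hΦ : ∀ k, 1 ≤ k → 0 ≤ Φ k)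
    (hdrift : ∀ S : Finset V, 2 ≤ S.card →
      flowExp P B (fun g => Φ (S.image g).card) ≤ Φ S.card - c)
    {S : Finset V} (hS : S.Nonempty) (N : ℕ) :
    ∑ t ∈ Finset.range N, flowExp P t (fun g => if (S.image g).card ≠ 1 then 1 else 0) ≤
      B / c * Φ S.card := by
  set a : Finset V → ℕ → ℝ := fun S t =>
    flowExp P t (fun g => if (S.image g).card ≠ 1 then (1 : ℝ) else 0) with ha
  have ha0 : ∀ S t, 0 ≤ a S t := fun S t => flowExp_nonneg hP t fun g => by
    split_ifs <;> norm_num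
  have ha1 : ∀ S t, a S t ≤ 1 := fun S t =>
    (flowExp_mono hP t fun g => by split_ifs <;> norm_num).trans_eq (flowExp_const hP t 1)
  have hBc : 0 ≤ (B : ℝ) / c := by positivity
  have key : ∀ J (S : Finset V), S.Nonempty →
      ∑ t ∈ Finset.range (J * B), a S t ≤ B / c * Φ S.card := by
    intro J
    induction J with
    | zero =>
      intro S hS
      simpa using mul_nonneg hBc (hΦ _ (Finset.card_pos.2 hS))
    | succ J ih =>
      intro S hS
      rcases Nat.lt_or_ge S.card 2 with h | h
      · have hS1 : S.card = 1 := by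
          have := Finset.card_pos.2 hS
          omega
        obtain ⟨v, rfl⟩ := Finset.card_eq_one.1 hS1
        have : ∀ t, a {v} t = 0 := by
          intro t
          simp only [ha, Finset.image_singleton, Finset.card_singleton, ne_eq, not_true,
            if_false, flowExp_const hP]
        simp only [this, Finset.sum_const_zero]
        exact mul_nonneg hBc (hΦ _ (by simp))
      · rw [Nat.succ_mul, Nat.add_comm, Finset.sum_range_add]
        have h1 : ∑ t ∈ Finset.range B, a S t ≤ B := by
          calc _ ≤ ∑ t ∈ Finset.range B, (1 : ℝ) := Finset.sum_le_sum fun t _ => ha1 S t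
            _ = B := by simp
        have h2 : ∑ t ∈ Finset.range (J * B), a S (B + t) =
            flowExp P B fun f => ∑ t ∈ Finset.range (J * B), a (S.image f) t := by
          rw [flowExp_sum]
          refine Finset.sum_congr rfl fun t _ => ?_
          simp only [ha, flowExp_add_time, Finset.image_image]
        have h3 : flowExp P B (fun f => ∑ t ∈ Finset.range (J * B), a (S.image f) t) ≤
            B / c * flowExp P B fun f => Φ (S.image f).card := by
          rw [← flowExp_const_mul]
          exact flowExp_mono hP B fun f => ih _ (hS.image f)
        have h4 := mul_le_mul_of_nonneg_left (hdrift S h) hBc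
        rw [h2]
        have h5 : B / c * (Φ S.card - c) = B / c * Φ S.card - B := by
          field_simp
        linarith
  refine le_trans ?_ (key N S hS)
  exact Finset.sum_le_sum_of_subset_of_nonneg
    (Finset.range_mono (Nat.le_mul_of_pos_right N hB)) fun t _ _ => ha0 S t

/-- The drift of a concave function of the number of particles, in terms of its derivative `Φ'`
and of the expected loss. -/
theorem flowExp_concave_le {P : V → V → ℝ} (hP : IsStoch P) (B : ℕ) {Φ Φ' : ℕ → ℝ} {c : ℝ}
    (hconc : ∀ j k : ℕ, 1 ≤ j → j ≤ k → Φ' k * ((k : ℝ) - j) ≤ Φ k - Φ j) {S : Finset V}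
    (hS : S.Nonempty)
    (hloss : c ≤ Φ' S.card * (S.card - flowExp P B fun g => ((S.image g).card : ℝ))) :
    flowExp P B (fun g => Φ (S.image g).card) ≤ Φ S.card - c := by
  have h1 : Φ' S.card * (S.card - flowExp P B fun g => ((S.image g).card : ℝ)) ≤
      Φ S.card - flowExp P B fun g => Φ (S.image g).card := by
    rw [← flowExp_const hP B (S.card : ℝ), ← flowExp_const hP B (Φ S.card), ← flowExp_sub,
      ← flowExp_sub, ← flowExp_const_mul]
    exact flowExp_mono hP B fun g =>
      hconc _ _ (Finset.card_pos.2 (hS.image g)) Finset.card_image_le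
  linarith

end Drift

/-! ### Bounds for the expected coalescence time of a chain -/

section CoalescenceBounds

variable {V : Type*} [Fintype V] [DecidableEq V]

theorem sub_div_le_log_sub_log {j k : ℕ} (hj : 1 ≤ j) (hjk : j ≤ k) :
    1 / (k : ℝ) * ((k : ℝ) - j) ≤ Real.log k - Real.log j := by
  have hj0 : (0 : ℝ) < j := by exact_mod_cast hj
  have hk0 : (0 : ℝ) < k := by exact_mod_cast hj.trans hjk
  have h := Real.log_le_sub_one_of_pos (div_pos hj0 hk0)
  rw [Real.log_div hj0.ne' hk0.ne'] at h
  have : 1 / (k : ℝ) * ((k : ℝ) - j) = 1 - j / k := by field_simp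
  linarith

/-- If any two walks meet within `N` steps with probability at least `1 / 2`, then the particles,
grouped in pairs, lose a constant fraction within `N` steps. -/
theorem sum_card_ne_one_le_of_half_le_meetProb {P : V → V → ℝ} (hP : IsStoch P) {N : ℕ}
    (hN : 1 ≤ N) (h : ∀ x y, 1 / 2 ≤ meetProb P N x y) {S : Finset V} (hS : S.Nonempty) (n : ℕ) :
    ∑ t ∈ Finset.range n, flowExp P t (fun g => if (S.image g).card ≠ 1 then 1 else 0) ≤
      6 * N * Real.log S.card := by
  have hpair : ∀ A : Finset V, A.card = 2 → 1 / 2 ≤ loss P (stepPow P 0) N A := by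
    intro A hA
    obtain ⟨u, v, huv, rfl⟩ := Finset.card_eq_two.1 hA
    have h0 : loss P (stepPow P 0) N {u, v} =
        flowExp P N fun g => ((({u, v} : Finset V).card : ℝ) - (({u, v} : Finset V).image g).card) :=
      indepExp_dirac (fun v => v) _
    rw [h0]
    refine (h u v).trans ?_
    rw [← flowExp_eq_meetProb hP]
    refine flowExp_mono hP N fun g => ?_
    rw [hA, Finset.image_insert, Finset.image_singleton]
    split_ifs with hg
    · simp [hg]
      norm_num
    · rw [Finset.card_pair hg]
      simp
  have hdrift : ∀ S : Finset V, 2 ≤ S.card →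
      flowExp P N (fun g => Real.log (S.image g).card) ≤ Real.log S.card - 1 / 6 := by
    intro S hS2
    refine flowExp_concave_le hP N (Φ := fun k => Real.log k) (Φ' := fun k => 1 / (k : ℝ))
      (fun j k => sub_div_le_log_sub_log) (Finset.card_pos.1 (by omega)) ?_
    have h1 := mul_le_loss hP (isStoch_stepPow hP 0) N hpair (S.card / 2) S
      (Nat.div_mul_le_self _ _)
    have h2 := loss_stepPow_le hP 0 N S
    rw [Nat.zero_add] at h2
    have h3 : (S.card : ℝ) ≤ 3 * (S.card / 2 : ℕ) := by
      have : S.card ≤ 3 * (S.card / 2) := by omega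
      exact_mod_cast this
    have hk0 : (0 : ℝ) < S.card := by
      have : 0 < S.card := by omega
      exact_mod_cast this
    rw [one_div_mul_eq_div, le_div_iff₀ hk0]
    linarith
  have := sum_card_ne_one_le hP hN (by norm_num : (0 : ℝ) < 1 / 6)
    (fun k hk => Real.log_nonneg (by exact_mod_cast hk)) hdrift hS n
  refine this.trans_eq ?_
  ring

/-- Over a block of `s + T` steps, of which the first `s` serve to mix, `k` particles lose a
fraction of order `p * min k (1 / √p)`, where `p` is the probability that two stationary walks
meet within `T` steps: they split into groups of size of order `min k (1 / √p)`, and almost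
every collision of two walks of a group is the only collision of these two walks within the
group. -/
theorem block_loss_ge {P : V → V → ℝ} (hP : IsStoch P) {π : V → ℝ} (hπ : IsStationary P π)
    {s T : ℕ} (hpos : 0 < statMeet P π T) (hmin : ∀ u v, 1 / 4 * π v ≤ stepPow P s u v)
    (S : Finset V) (hS : 2 ≤ S.card) :
    S.card * (statMeet P π T * min (S.card : ℝ) (1 / √(statMeet P π T))) / 2560 ≤
      S.card - flowExp P (s + T) fun g => ((S.image g).card : ℝ) := by
  refine le_trans ?_ (loss_stepPow_le hP s T S)
  set p := statMeet P π T with hp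
  have hsp : 0 < √p := Real.sqrt_pos.2 hpos
  set x : ℝ := 1 / (5 * √p) with hx
  have hx0 : 0 < x := by positivity
  have hxp : x * √p = 1 / 5 := by
    rw [hx]
    field_simp
  set m := min S.card (max 2 ⌊x⌋₊) with hm
  have hm2 : 2 ≤ m := le_min hS (le_max_left _ _)
  have hmS : m ≤ S.card := min_le_left _ _
  have hm2' : (2 : ℝ) ≤ m := by exact_mod_cast hm2
  have hmx : (m : ℝ) - 2 ≤ x := by
    have h1 : m ≤ max 2 ⌊x⌋₊ := min_le_right _ _
    have h2 : ((max 2 ⌊x⌋₊ : ℕ) : ℝ) ≤ x + 2 := by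
      rw [Nat.cast_max]
      refine max_le (by push_cast; linarith) ?_
      linarith [Nat.floor_le hx0.le]
    have h3 : (m : ℝ) ≤ (max 2 ⌊x⌋₊ : ℕ) := by exact_mod_cast h1
    linarith
  have hgroup : ∀ A : Finset V, A.card = m →
      (m : ℝ) * (m - 1) * ((1 / 4) ^ 2 * p / 4) ≤ loss P (stepPow P s) T A := by
    intro A hA
    rw [← hA]
    refine group_loss_ge hP (isStoch_stepPow hP s) hπ (avgMeet_le hP hπ hpos) (by norm_num)
      hmin A ?_
    rw [hA]
    have := mul_le_mul_of_nonneg_right hmx hsp.le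
    rw [← hp]
    linarith
  have h1 := mul_le_loss hP (isStoch_stepPow hP s) T hgroup (S.card / m) S
    (Nat.div_mul_le_self _ _)
  refine le_trans ?_ h1
  have hdiv : (S.card : ℝ) ≤ 2 * ((S.card / m : ℕ) * m) := by
    have h2 : S.card < (S.card / m) * m + m := by
      have := Nat.div_add_mod S.card m
      have h3 := Nat.mod_lt S.card (by omega : 0 < m)
      rw [mul_comm] at this
      omega
    have h3 : m ≤ (S.card / m) * m := Nat.le_mul_of_pos_left m (Nat.div_pos hmS (by omega))
    have : S.card ≤ 2 * ((S.card / m) * m) := by omega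
    exact_mod_cast this
  have hmlow : min (S.card : ℝ) (1 / √p) ≤ 10 * m := by
    have hfl : x ≤ 2 * (max 2 ⌊x⌋₊ : ℕ) := by
      rw [Nat.cast_max]
      have h4 := Nat.lt_floor_add_one x
      have h5 : (2 : ℝ) ≤ max ((2 : ℕ) : ℝ) ⌊x⌋₊ := le_max_left _ _
      have h6 : (⌊x⌋₊ : ℝ) ≤ max ((2 : ℕ) : ℝ) ⌊x⌋₊ := le_max_right _ _
      linarith
    have hxe : 1 / √p = 5 * x := by
      rw [hx]
      field_simp
    rw [hm, Nat.cast_min, hxe, mul_min_of_nonneg _ _ (by norm_num : (0 : ℝ) ≤ 10)]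
    have hS0 : (0 : ℝ) ≤ S.card := Nat.cast_nonneg _
    refine min_le_min ?_ ?_ <;> linarith
  have hmin0 : 0 ≤ min (S.card : ℝ) (1 / √p) := le_min (Nat.cast_nonneg _) (by positivity)
  calc S.card * (p * min (S.card : ℝ) (1 / √p)) / 2560
      ≤ (2 * ((S.card / m : ℕ) * m)) * (p * (10 * m)) / 2560 := by
        gcongr
    _ = (S.card / m : ℕ) * (m * (m / 2) * ((1 / 4) ^ 2 * p / 4)) := by ring
    _ ≤ (S.card / m : ℕ) * (m * (m - 1) * ((1 / 4) ^ 2 * p / 4)) := by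
        gcongr
        linarith

/-- The drift criterion for `(1 - 1 / k) / p + log k / √p`, whose derivative is of the order of the
inverse of the mean loss of `k` particles in a block. -/
theorem sum_card_ne_one_le_of_statMeet {P : V → V → ℝ} (hP : IsStoch P) {π : V → ℝ}
    (hπ : IsStationary P π) {s T : ℕ} (hB : 1 ≤ s + T) (hpos : 0 < statMeet P π T)
    (hmin : ∀ u v, 1 / 4 * π v ≤ stepPow P s u v) {S : Finset V} (hS : S.Nonempty) (n : ℕ) :
    ∑ t ∈ Finset.range n, flowExp P t (fun g => if (S.image g).card ≠ 1 then 1 else 0) ≤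
      2560 * (s + T : ℕ) *
        (1 / statMeet P π T + Real.log S.card / √(statMeet P π T)) := by
  set p := statMeet P π T with hp
  have hsp : 0 < √p := Real.sqrt_pos.2 hpos
  have hsq : √p * √p = p := Real.mul_self_sqrt hpos.le
  set Φ : ℕ → ℝ := fun k => (1 - 1 / (k : ℝ)) / p + Real.log k / √p with hΦ
  set Φ' : ℕ → ℝ := fun k => 1 / ((k : ℝ) ^ 2 * p) + 1 / ((k : ℝ) * √p) with hΦ'
  have hconc : ∀ j k : ℕ, 1 ≤ j → j ≤ k → Φ' k * ((k : ℝ) - j) ≤ Φ k - Φ j := by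
    intro j k hj hjk
    have hj0 : (0 : ℝ) < j := by exact_mod_cast hj
    have hjk' : (j : ℝ) ≤ k := by exact_mod_cast hjk
    have hk0 : (0 : ℝ) < k := hj0.trans_le hjk'
    have h1 := div_le_div_of_nonneg_right (sub_div_le_log_sub_log hj hjk) hsp.le
    have h2 : ((k : ℝ) - j) / k ^ 2 ≤ 1 / j - 1 / k := by
      have : 1 / (j : ℝ) - 1 / k = (k - j) / (j * k) := by field_simp
      rw [this]
      refine div_le_div_of_nonneg_left (sub_nonneg.2 hjk') (by positivity) ?_
      nlinarith
    have h3 := div_le_div_of_nonneg_right h2 hpos.le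
    have e1 : Φ' k * ((k : ℝ) - j) = ((k : ℝ) - j) / k ^ 2 / p + 1 / (k : ℝ) * (k - j) / √p := by
      simp only [hΦ']
      field_simp
    have e2 : Φ k - Φ j = (1 / (j : ℝ) - 1 / k) / p + (Real.log k - Real.log j) / √p := by
      simp only [hΦ]
      ring
    rw [e1, e2]
    exact add_le_add h3 h1
  have hΦ0 : ∀ k, 1 ≤ k → 0 ≤ Φ k := by
    intro k hk
    have hk1 : (1 : ℝ) ≤ k := by exact_mod_cast hk
    refine add_nonneg (div_nonneg ?_ hpos.le) (div_nonneg (Real.log_nonneg hk1) hsp.le)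
    exact sub_nonneg.2 (div_le_one_of_le₀ hk1 (by linarith))
  have hdrift : ∀ S : Finset V, 2 ≤ S.card →
      flowExp P (s + T) (fun g => Φ (S.image g).card) ≤ Φ S.card - 1 / 2560 := by
    intro S hS2
    refine flowExp_concave_le hP _ hconc (Finset.card_pos.1 (by omega)) ?_
    have hk0 : (0 : ℝ) < S.card := by
      have : 0 < S.card := by omega
      exact_mod_cast this
    have hΦ'0 : 0 ≤ Φ' S.card := by positivity
    refine le_trans ?_ (mul_le_mul_of_nonneg_left
      (block_loss_ge hP hπ hpos hmin S hS2) hΦ'0)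
    rw [← hp]
    have hone : 1 ≤ Φ' S.card * (S.card * (p * min (S.card : ℝ) (1 / √p))) := by
      rcases min_choice (S.card : ℝ) (1 / √p) with h | h <;> rw [h]
      · have : 1 / ((S.card : ℝ) ^ 2 * p) * (S.card * (p * S.card)) = 1 := by field_simp
        have h2 : 0 ≤ 1 / ((S.card : ℝ) * √p) * (S.card * (p * S.card)) := by positivity
        simp only [hΦ', add_mul]
        linarith
      · have : 1 / ((S.card : ℝ) * √p) * (S.card * (p * (1 / √p))) = 1 := by
          field_simp
          rw [sq, hsq]
        have h2 : 0 ≤ 1 / ((S.card : ℝ) ^ 2 * p) * (S.card * (p * (1 / √p))) := by positivity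
        simp only [hΦ', add_mul]
        linarith
    linarith
  have h := sum_card_ne_one_le hP hB (by norm_num : (0 : ℝ) < 1 / 2560) hΦ0 hdrift hS n
  refine h.trans ?_
  have e : ((s + T : ℕ) : ℝ) / (1 / 2560) = 2560 * (s + T : ℕ) := by ring
  rw [e]
  refine mul_le_mul_of_nonneg_left ?_ (by positivity)
  refine add_le_add_left (div_le_div_of_nonneg_right ?_ hpos.le) _
  have : 0 ≤ 1 / (S.card : ℝ) := by positivity
  linarith

end CoalescenceBounds

/-! ### First-step analysis of the path measure -/

section HittingTimes

theorem toENNReal_eq_tsum (a : ℕ∞) :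
    (a : ℝ≥0∞) = ∑' t : ℕ, if (t : ℕ∞) < a then 1 else 0 := by
  induction a with
  | top => simp
  | coe n =>
    rw [tsum_eq_sum (s := Finset.range n)]
    · simp only [Nat.cast_lt]
      rw [Finset.sum_congr rfl fun t ht => if_pos (Finset.mem_range.1 ht)]
      simp
    · intro t ht
      simpa using ht

open Classical in
theorem toENNReal_iInf_eq_tsum (p : ℕ → Prop) :
    ((⨅ (t : ℕ) (_ : p t), (t : ℕ∞) : ℕ∞) : ℝ≥0∞) =
      ∑' t : ℕ, if ∀ s ≤ t, ¬ p s then 1 else 0 := by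
  rw [toENNReal_eq_tsum]
  refine tsum_congr fun t => ?_
  congr 1
  rw [eq_iff_iff]
  constructor
  · intro h s hs hp
    exact absurd (h.trans_le (iInf₂_le s hp)) (by simpa using hs)
  · intro h
    refine lt_of_lt_of_le (b := ((t + 1 : ℕ) : ℕ∞)) (by exact_mod_cast Nat.lt_succ_self t) ?_
    refine le_iInf₂ fun s hp => ?_
    have : t < s := by
      by_contra hs
      exact h s (not_lt.1 hs) hp
    exact_mod_cast this

end HittingTimes

section Moves

variable {V : Type*}

/-- The family of moves that starts with `f` and continues with `ω`. -/
def consMoves (f : V → V) (ω : ℕ → V → V) : ℕ → V → V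
  | 0 => f
  | t + 1 => ω t

theorem walk_consMoves (f : V → V) (ω : ℕ → V → V) (u : V) (t : ℕ) :
    walk (consMoves f ω) u (t + 1) = walk ω (f u) t := by
  induction t with
  | zero => rfl
  | succ t ih => rw [walk, ih]; rfl

theorem active_eq_image [DecidableEq V] (ω : ℕ → V → V) (S : Finset V) (t : ℕ) :
    active ω S t = S.image fun v => walk ω v t := by
  induction t with
  | zero => simp [active, walk]
  | succ t ih => rw [active, ih, Finset.image_image]; rfl

variable [Fintype V] [DecidableEq V] (G : SimpleGraph V) [DecidableRel G.Adj]

/-- The one-step transition probabilities as real numbers. -/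
noncomputable def stepMat (u v : V) : ℝ := (transition G u v).toReal

theorem transition_ne_top (u v : V) : transition G u v ≠ ∞ := by
  have h := sum_transition G u
  have h1 : transition G u v ≤ 1 := by
    rw [← h]
    exact Finset.single_le_sum (fun _ _ => zero_le) (Finset.mem_univ v)
  exact ne_top_of_le_ne_top ENNReal.one_ne_top h1

theorem isStoch_stepMat : IsStoch (stepMat G) := by
  refine ⟨fun u v => ENNReal.toReal_nonneg, fun u => ?_⟩
  simp only [stepMat]
  rw [← ENNReal.toReal_sum fun v _ => transition_ne_top G u v, sum_transition, ENNReal.toReal_one]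

variable [MeasurableSpace V] [DiscreteMeasurableSpace V]

instance : IsProbabilityMeasure (moves G) := by
  unfold moves
  infer_instance

theorem measurable_consMoves :
    Measurable fun p : (V → V) × (ℕ → V → V) => consMoves p.1 p.2 := by
  rw [measurable_pi_iff]
  intro t
  cases t with
  | zero => exact measurable_fst
  | succ t => exact (measurable_pi_apply t).comp measurable_snd

theorem map_consMoves :
    ((Measure.pi fun v : V => (step G v).toMeasure).prod (moves G)).map
      (fun p : (V → V) × (ℕ → V → V) => consMoves p.1 p.2) = moves G := by
  refine Measure.eq_infinitePi _ fun s B hB => ?_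
  set μ := Measure.pi fun v : V => (step G v).toMeasure with hμ
  have hmeas : MeasurableSet (Set.pi (s : Set ℕ) B) :=
    MeasurableSet.pi s.countable_toSet fun i _ => hB i
  rw [Measure.map_apply measurable_consMoves hmeas]
  -- the later times of `s`, shifted by one
  let s' : Finset ℕ := (Finset.range (s.sup id)).filter fun t => t + 1 ∈ s
  have hs' : ∀ t, t ∈ s' ↔ t + 1 ∈ s := by
    intro t
    refine ⟨fun h => (Finset.mem_filter.1 h).2, fun h => Finset.mem_filter.2 ⟨?_, h⟩⟩
    exact Finset.mem_range.2 (Nat.lt_of_succ_le (Finset.le_sup (f := id) h))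
  let B0 : Set (V → V) := if 0 ∈ s then B 0 else Set.univ
  have hpre : (fun p : (V → V) × (ℕ → V → V) => consMoves p.1 p.2) ⁻¹' Set.pi (s : Set ℕ) B =
      B0 ×ˢ Set.pi (s' : Set ℕ) fun t => B (t + 1) := by
    ext ⟨f, ω⟩
    simp only [Set.mem_preimage, Set.mem_pi, Finset.mem_coe, Set.mem_prod, hs']
    constructor
    · intro h
      refine ⟨?_, fun t ht => h (t + 1) ht⟩
      by_cases h0 : 0 ∈ s
      · simpa [B0, h0, consMoves] using h 0 h0
      · simp [B0, h0]
    · rintro ⟨h0, h⟩ t ht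
      cases t with
      | zero => simpa [B0, ht, consMoves] using h0
      | succ t => exact h t ht
  have hsplit : s = (if 0 ∈ s then {0} else ∅) ∪ s'.image Nat.succ := by
    ext t
    cases t with
    | zero => by_cases h0 : 0 ∈ s <;> simp [h0]
    | succ t => by_cases h0 : 0 ∈ s <;> simp [h0, hs']
  have hdisj : Disjoint (if 0 ∈ s then ({0} : Finset ℕ) else ∅) (s'.image Nat.succ) := by
    rw [Finset.disjoint_left]
    intro t ht ht'
    obtain ⟨t', -, rfl⟩ := Finset.mem_image.1 ht'
    split_ifs at ht <;> simp at ht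
  rw [hpre, Measure.prod_prod, moves, Measure.infinitePi_pi _ fun t _ => hB (t + 1)]
  conv_rhs => rw [hsplit, Finset.prod_union hdisj, Finset.prod_image Nat.succ_injective.injOn]
  congr 1
  by_cases h0 : 0 ∈ s
  · simp [B0, h0]
  · simp [B0, h0]

/-- First-step analysis. -/
theorem lintegral_moves {F : (ℕ → V → V) → ℝ≥0∞} (hF : Measurable F) :
    ∫⁻ ω, F ω ∂(moves G) = ∑ f : V → V, ENNReal.ofReal (∏ v, stepMat G v (f v)) *
      ∫⁻ ω, F (consMoves f ω) ∂(moves G) := by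
  conv_lhs => rw [← map_consMoves G]
  rw [lintegral_map hF measurable_consMoves,
    lintegral_prod (fun p : (V → V) × (ℕ → V → V) => F (consMoves p.1 p.2))
      (hF.comp measurable_consMoves).aemeasurable, lintegral_fintype]
  refine Finset.sum_congr rfl fun f _ => ?_
  rw [mul_comm, Measure.pi_singleton]
  congr 1
  rw [ENNReal.ofReal_prod_of_nonneg fun v _ => (isStoch_stepMat G).nonneg _ _]
  refine Finset.prod_congr rfl fun v _ => ?_
  rw [PMF.toMeasure_apply_singleton _ _ (measurableSet_singleton _), stepMat,
    ENNReal.ofReal_toReal (transition_ne_top G _ _)]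
  rfl

theorem lintegral_moves_prod {F : (ℕ → V → V) × (ℕ → V → V) → ℝ≥0∞} (hF : Measurable F) :
    ∫⁻ p, F p ∂((moves G).prod (moves G)) =
      ∑ f : V → V, ENNReal.ofReal (∏ v, stepMat G v (f v)) *
        ∑ g : V → V, ENNReal.ofReal (∏ v, stepMat G v (g v)) *
          ∫⁻ p, F (consMoves f p.1, consMoves g p.2) ∂((moves G).prod (moves G)) := by
  have hc : ∀ f : V → V, Measurable fun ω => consMoves f ω := fun f =>
    measurable_consMoves.comp (measurable_const.prodMk measurable_id)
  rw [lintegral_prod _ hF.aemeasurable, lintegral_moves G hF.lintegral_prod_right']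
  refine Finset.sum_congr rfl fun f _ => ?_
  congr 1
  have h1 : ∀ ω, ∫⁻ ω', F (consMoves f ω, ω') ∂(moves G) =
      ∑ g : V → V, ENNReal.ofReal (∏ v, stepMat G v (g v)) *
        ∫⁻ ω', F (consMoves f ω, consMoves g ω') ∂(moves G) := fun ω =>
    lintegral_moves G (hF.comp (measurable_const.prodMk measurable_id))
  have h2 : ∀ g : V → V, Measurable fun p : (ℕ → V → V) × (ℕ → V → V) =>
      F (consMoves f p.1, consMoves g p.2) := fun g =>
    hF.comp (((hc f).comp measurable_fst).prodMk ((hc g).comp measurable_snd))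
  simp only [h1]
  rw [lintegral_finsetSum _ fun g _ => (h2 g).lintegral_prod_right'.const_mul _]
  refine Finset.sum_congr rfl fun g _ => ?_
  rw [lintegral_const_mul _ (h2 g).lintegral_prod_right', lintegral_prod _ (h2 g).aemeasurable]

theorem measurable_walk (u : V) (t : ℕ) : Measurable fun ω : ℕ → V → V => walk ω u t := by
  induction t with
  | zero => exact measurable_const
  | succ t ih =>
    have h : Measurable fun p : (V → V) × V => p.1 p.2 := Measurable.of_discrete
    exact h.comp ((measurable_pi_apply t).prodMk ih)

theorem sum_ofReal_mul_ofReal {φ : (V → V) → ℝ} (hφ : ∀ f, 0 ≤ φ f) :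
    ∑ f : V → V, ENNReal.ofReal (∏ v, stepMat G v (f v)) * ENNReal.ofReal (φ f) =
      ENNReal.ofReal (indepExp (stepMat G) φ) := by
  have h0 : ∀ f : V → V, 0 ≤ ∏ v, stepMat G v (f v) := fun f =>
    Finset.prod_nonneg fun v _ => (isStoch_stepMat G).nonneg _ _
  rw [indepExp, ENNReal.ofReal_sum_of_nonneg fun f _ => mul_nonneg (h0 f) (hφ f)]
  exact Finset.sum_congr rfl fun f _ => (ENNReal.ofReal_mul (h0 f)).symm

/-- Under `moves G`, the map that sends each vertex to the position at time `t` of the walk that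
starts there has the law described by `flowExp`. -/
theorem lintegral_walk (t : ℕ) {φ : (V → V) → ℝ} (hφ : ∀ f, 0 ≤ φ f) :
    ∫⁻ ω, ENNReal.ofReal (φ fun v => walk ω v t) ∂(moves G) =
      ENNReal.ofReal (flowExp (stepMat G) t φ) := by
  induction t generalizing φ with
  | zero =>
    simp only [walk, lintegral_const, measure_univ, mul_one, flowExp]
    rfl
  | succ t ih =>
    have hmeas : Measurable fun ω : ℕ → V → V => ENNReal.ofReal (φ fun v => walk ω v (t + 1)) :=
      (Measurable.of_discrete (f := fun g : V → V => ENNReal.ofReal (φ g))).comp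
        (measurable_pi_iff.2 fun v => measurable_walk v (t + 1))
    rw [lintegral_moves G hmeas, flowExp, ← sum_ofReal_mul_ofReal]
    · refine Finset.sum_congr rfl fun f _ => ?_
      simp only [walk_consMoves]
      rw [← ih fun g => hφ _]
      rfl
    · exact fun f => flowExp_nonneg (isStoch_stepMat G) t fun g => hφ _

theorem indepExp_single {q : V → V → ℝ} (hq : IsStoch q) (u : V) (φ : V → ℝ) :
    indepExp q (fun z => φ (z u)) = ∑ a, q u a * φ a := by
  have h := indepExp_comp_injective hq
    (e := fun _ : Fin 1 => u) (fun a b _ => Subsingleton.elim a b) (fun z => φ (z 0))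
  rw [show indepExp q (fun z => φ (z u)) = _ from h, indepExp_fin_succ]
  simp [indepExp]

theorem flowExp_eq_stepPow {P : V → V → ℝ} (hP : IsStoch P) (t : ℕ) (u v : V) :
    flowExp P t (fun g => if g u = v then 1 else 0) = stepPow P t u v := by
  induction t generalizing u with
  | zero => simp [flowExp, stepPow, eq_comm]
  | succ t ih =>
    simp only [flowExp, Function.comp, ih]
    rw [indepExp_single hP u fun a => stepPow P t a v, stepPow]

theorem prob_eq_stepPow (t : ℕ) (u v : V) : prob G t u v = stepPow (stepMat G) t u v := by
  have h := lintegral_walk G t (φ := fun g => if g u = v then (1 : ℝ) else 0)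
    (fun f => by split_ifs <;> norm_num)
  rw [flowExp_eq_stepPow (isStoch_stepMat G)] at h
  have hset : MeasurableSet {ω : ℕ → V → V | walk ω u t = v} :=
    measurable_walk u t (measurableSet_singleton v)
  have h2 : ∫⁻ ω, ENNReal.ofReal (if walk ω u t = v then (1 : ℝ) else 0) ∂(moves G) =
      moves G {ω | walk ω u t = v} := by
    rw [← lintegral_indicator_one hset]
    refine lintegral_congr fun ω => ?_
    by_cases hω : walk ω u t = v <;> simp [Set.indicator, hω]
  rw [prob, Measure.real, ← h2, h,
    ENNReal.toReal_ofReal ((isStoch_stepPow (isStoch_stepMat G) t).nonneg _ _)]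

open Classical in
theorem lintegral_not_met (t : ℕ) (u v : V) :
    ∫⁻ p : (ℕ → V → V) × (ℕ → V → V),
      (if ∀ s ≤ t, ¬ walk p.1 u s = walk p.2 v s then 1 else 0) ∂((moves G).prod (moves G)) =
      ENNReal.ofReal (1 - meetProb (stepMat G) t u v) := by
  have hP := isStoch_stepMat G
  induction t generalizing u v with
  | zero =>
    simp only [Nat.le_zero, forall_eq, walk, lintegral_const, measure_univ, mul_one, meetProb]
    by_cases h : u = v <;> simp [h]
  | succ t ih =>
    rcases eq_or_ne u v with rfl | huv
    · have : ∀ p : (ℕ → V → V) × (ℕ → V → V),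
          ¬ ∀ s ≤ t + 1, ¬ walk p.1 u s = walk p.2 u s := fun p h => h 0 (Nat.zero_le _) rfl
      simp [this, meetProb_self]
    · have hmeas : Measurable fun p : (ℕ → V → V) × (ℕ → V → V) =>
          if ∀ s ≤ t + 1, ¬ walk p.1 u s = walk p.2 v s then (1 : ℝ≥0∞) else 0 := by
        refine Measurable.ite ?_ measurable_const measurable_const
        simp only [Set.ofPred_forall]
        refine MeasurableSet.iInter fun s => MeasurableSet.iInter fun _ => MeasurableSet.compl ?_
        exact measurableSet_eq_fun ((measurable_walk u s).comp measurable_fst)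
          ((measurable_walk v s).comp measurable_snd)
      have hiff : ∀ (f g : V → V) (p : (ℕ → V → V) × (ℕ → V → V)),
          (∀ s ≤ t + 1, ¬ walk (consMoves f p.1) u s = walk (consMoves g p.2) v s) ↔
            ∀ s ≤ t, ¬ walk p.1 (f u) s = walk p.2 (g v) s := by
        intro f g p
        constructor
        · intro h s hs
          have := h (s + 1) (by omega)
          rwa [walk_consMoves, walk_consMoves] at this
        · intro h s hs
          cases s with
          | zero => exact huv
          | succ s =>
            rw [walk_consMoves, walk_consMoves]
            exact h s (by omega)
      have hnn : ∀ a b, 0 ≤ 1 - meetProb (stepMat G) t a b := fun a b =>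
        sub_nonneg.2 (meetProb_le_one hP t a b)
      rw [lintegral_moves_prod G hmeas]
      simp only [hiff, ih]
      simp only [sum_ofReal_mul_ofReal G (fun g : V → V => hnn _ (g v))]
      have hin : ∀ f : V → V, 0 ≤ indepExp (stepMat G) fun g : V → V =>
          1 - meetProb (stepMat G) t (f u) (g v) := fun f =>
        (indepExp_const hP 0).symm.le.trans (indepExp_mono hP fun g => hnn _ _)
      rw [sum_ofReal_mul_ofReal G hin, meetProb_succ_of_ne _ t huv]
      congr 1
      simp only [fun a => indepExp_single hP v fun b => 1 - meetProb (stepMat G) t a b]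
      rw [indepExp_single hP u fun a => ∑ b, stepMat G v b * (1 - meetProb (stepMat G) t a b)]
      have hsub : 1 - pairStep (stepMat G) (meetProb (stepMat G) t) u v =
          pairStep (stepMat G) (fun a b => 1 - meetProb (stepMat G) t a b) u v := by
        rw [pairStep_sub, pairStep_const hP]
      rw [hsub]
      simp only [pairStep, Finset.mul_sum, mul_assoc]

theorem meet_eq_tsum (u v : V) :
    meet G u v = ∑' t, ENNReal.ofReal (1 - meetProb (stepMat G) t u v) := by
  classical
  simp only [meet, meetTime, toENNReal_iInf_eq_tsum]
  rw [lintegral_tsum]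
  · refine tsum_congr fun t => ?_
    convert lintegral_not_met G t u v
  · intro t
    refine (Measurable.ite ?_ measurable_const measurable_const).aemeasurable
    simp only [Set.ofPred_forall]
    refine MeasurableSet.iInter fun s => MeasurableSet.iInter fun _ => MeasurableSet.compl ?_
    exact measurableSet_eq_fun ((measurable_walk u s).comp measurable_fst)
      ((measurable_walk v s).comp measurable_snd)

theorem card_active_antitone (ω : ℕ → V → V) (S : Finset V) :
    Antitone fun t => (active ω S t).card :=
  antitone_nat_of_succ_le fun _ => Finset.card_image_le

theorem tCoal_eq_tsum [Nonempty V] :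
    tCoal G = ∑' t, ENNReal.ofReal (flowExp (stepMat G) t fun g =>
      if (Finset.univ.image g).card ≠ 1 then 1 else 0) := by
  classical
  have hnn : ∀ f : V → V, 0 ≤ if (Finset.univ.image f).card ≠ 1 then (1 : ℝ) else 0 := fun f => by
    split_ifs <;> norm_num
  have hiff : ∀ (ω : ℕ → V → V) (t : ℕ), (∀ s ≤ t, ¬ (active ω Finset.univ s).card = 1) ↔
      (Finset.univ.image fun v => walk ω v t).card ≠ 1 := by
    intro ω t
    rw [← active_eq_image]
    refine ⟨fun h => h t le_rfl, fun h s hs h1 => h ?_⟩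
    have h2 := card_active_antitone ω Finset.univ hs
    simp only [h1] at h2
    have h3 : 0 < (active ω (Finset.univ : Finset V) t).card := by
      rw [active_eq_image]
      exact Finset.card_pos.2 (Finset.univ_nonempty.image _)
    omega
  have hcongr : ∀ (ω : ℕ → V → V) (t : ℕ),
      (if (Finset.univ.image fun v => walk ω v t).card ≠ 1 then (1 : ℝ≥0∞) else 0) =
      ENNReal.ofReal (if (Finset.univ.image fun v => walk ω v t).card ≠ 1 then (1 : ℝ) else 0) := by
    intro ω t
    split_ifs <;> simp
  simp only [tCoal, coalTime, toENNReal_iInf_eq_tsum, hiff, hcongr]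
  rw [lintegral_tsum]
  · exact tsum_congr fun t => lintegral_walk G t hnn
  · intro t
    exact ((Measurable.of_discrete (f := fun g : V → V => ENNReal.ofReal
      (if (Finset.univ.image g).card ≠ 1 then (1 : ℝ) else 0))).comp
        (measurable_pi_iff.2 fun v => measurable_walk v t)).aemeasurable

end Moves

/-! ### Mixing, meeting and coalescence on graphs -/

section Mixing

variable {V : Type*} [Fintype V] [DecidableEq V]

theorem pairStep_sum (P : V → V → ℝ) (F : V → V → V → ℝ) (u v : V) :
    pairStep P (fun a b => ∑ x, F x a b) u v = ∑ x, pairStep P (F x) u v := by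
  simp only [pairStep, Finset.mul_sum]
  symm
  rw [Finset.sum_comm]
  refine Finset.sum_congr rfl fun a _ => ?_
  rw [Finset.sum_comm]

theorem tvDist_eq_one_sub_sum_min {p q : V → ℝ} (hp : ∑ x, p x = 1) (hq : ∑ x, q x = 1) :
    tvDist p q = 1 - ∑ x, min (p x) (q x) := by
  have h : ∀ x, |p x - q x| = p x + q x - 2 * min (p x) (q x) := by
    intro x
    rcases le_total (p x) (q x) with h | h
    · rw [abs_of_nonpos (by linarith), min_eq_left h]; ring
    · rw [abs_of_nonneg (by linarith), min_eq_right h]; ring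
  simp only [tvDist, h, Finset.sum_sub_distrib, Finset.sum_add_distrib, hp, hq, ← Finset.mul_sum]
  ring

/-- The coupling inequality, for two walks that are independent until they meet. -/
theorem tvDist_stepPow_le {P : V → V → ℝ} (hP : IsStoch P) (t : ℕ) (u v : V) :
    tvDist (stepPow P t u) (stepPow P t v) ≤ 1 - meetProb P t u v := by
  have hself : ∀ t u, tvDist (stepPow P t u) (stepPow P t u) ≤ 1 - meetProb P t u u := by
    intro t u
    simp [tvDist, meetProb_self]
  induction t generalizing u v with
  | zero =>
    rcases eq_or_ne u v with rfl | h
    · exact hself 0 u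
    · have hs := isStoch_stepPow hP 0
      rw [tvDist_eq_one_sub_sum_min (hs.sum_eq_one u) (hs.sum_eq_one v), meetProb_zero_of_ne P h]
      have : 0 ≤ ∑ x, min (stepPow P 0 u x) (stepPow P 0 v x) :=
        Finset.sum_nonneg fun x _ => le_min (hs.nonneg _ _) (hs.nonneg _ _)
      linarith
  | succ t ih =>
    rcases eq_or_ne u v with rfl | h
    · exact hself _ u
    · rw [meetProb_succ_of_ne P t h]
      have hsub : 1 - pairStep P (meetProb P t) u v =
          pairStep P (fun a b => 1 - meetProb P t a b) u v := by
        rw [pairStep_sub, pairStep_const hP]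
      rw [hsub]
      refine le_trans ?_ (pairStep_mono hP ih u v)
      have hdiff : ∀ x, |stepPow P (t + 1) u x - stepPow P (t + 1) v x| ≤
          pairStep P (fun a b => |stepPow P t a x - stepPow P t b x|) u v := by
        intro x
        have : stepPow P (t + 1) u x - stepPow P (t + 1) v x =
            pairStep P (fun a b => stepPow P t a x - stepPow P t b x) u v := by
          rw [pairStep_sub, pairStep_fst hP (fun a => stepPow P t a x),
            pairStep_snd hP (fun b => stepPow P t b x)]
          rfl
        rw [this]
        refine (Finset.abs_sum_le_sum_abs _ _).trans (Finset.sum_le_sum fun a _ => ?_)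
        refine (Finset.abs_sum_le_sum_abs _ _).trans (Finset.sum_le_sum fun b _ => ?_)
        rw [abs_mul, abs_of_nonneg (mul_nonneg (hP.nonneg _ _) (hP.nonneg _ _))]
      have hsum : pairStep P (fun a b => tvDist (stepPow P t a) (stepPow P t b)) u v =
          (1 / 2) * ∑ x, pairStep P (fun a b => |stepPow P t a x - stepPow P t b x|) u v := by
        simp only [tvDist]
        rw [pairStep_const_mul, pairStep_sum]
      rw [hsum, tvDist]
      exact mul_le_mul_of_nonneg_left (Finset.sum_le_sum fun x _ => hdiff x) (by norm_num)

/-- For a reversible chain, closeness of all rows in total variation after `t` steps gives a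
pointwise lower bound after `2 * t` steps. -/
theorem mul_le_stepPow_add_self {P : V → V → ℝ} (hP : IsStoch P) {π : V → ℝ}
    (hπ : IsStationary P π) (hpos : ∀ v, 0 < π v) (hrev : ∀ u v, π u * P u v = π v * P v u)
    {t : ℕ} {u v : V} (h : tvDist (stepPow P t u) (stepPow P t v) ≤ 1 / 2) :
    1 / 4 * π v ≤ stepPow P (t + t) u v := by
  have hs := isStoch_stepPow hP t
  rw [tvDist_eq_one_sub_sum_min (hs.sum_eq_one u) (hs.sum_eq_one v)] at h
  set m : V → ℝ := fun x => min (stepPow P t u x) (stepPow P t v x) with hm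
  have hm1 : (1 : ℝ) / 2 ≤ ∑ x, m x := by linarith
  have hcs := Finset.sq_sum_div_le_sum_sq_div Finset.univ m (g := π) fun x _ => hpos x
  rw [hπ.sum_eq_one, div_one] at hcs
  have h4 : (1 : ℝ) / 4 ≤ ∑ x, m x ^ 2 / π x := by nlinarith
  rw [stepPow_add, mul_comm]
  refine (mul_le_mul_of_nonneg_left h4 (hpos v).le).trans ?_
  rw [Finset.mul_sum]
  refine Finset.sum_le_sum fun x _ => ?_
  have hr := stepPow_reversible hrev t x v
  have hm0 : 0 ≤ m x := le_min (hs.nonneg _ _) (hs.nonneg _ _)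
  have hx : stepPow P t x v = π v * stepPow P t v x / π x := by
    rw [← hr, mul_div_cancel_left₀ _ (hpos x).ne']
  rw [hx, ← mul_div_assoc, ← mul_div_assoc]
  refine div_le_div_of_nonneg_right ?_ (hpos x).le
  have h5 : m x * m x ≤ stepPow P t u x * stepPow P t v x :=
    mul_le_mul (min_le_left _ _) (min_le_right _ _) hm0 (hs.nonneg _ _)
  calc π v * m x ^ 2 = π v * (m x * m x) := by ring
    _ ≤ π v * (stepPow P t u x * stepPow P t v x) := mul_le_mul_of_nonneg_left h5 (hpos v).le
    _ = _ := by ring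

/-- The probability that two walks have not met is submultiplicative in time. -/
theorem one_sub_meetProb_add_le {P : V → V → ℝ} (hP : IsStoch P) {t : ℕ} {c : ℝ}
    (hc : ∀ a b, 1 - meetProb P t a b ≤ c) (s : ℕ) (u v : V) :
    1 - meetProb P (s + t) u v ≤ c * (1 - meetProb P s u v) := by
  induction s generalizing u v with
  | zero =>
    rcases eq_or_ne u v with rfl | h
    · simp [meetProb_self]
    · simpa [meetProb_zero_of_ne P h] using hc u v
  | succ s ih =>
    rcases eq_or_ne u v with rfl | h
    · simp [meetProb_self]
    · have hsub : ∀ g : V → V → ℝ, 1 - pairStep P g u v =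
          pairStep P (fun a b => 1 - g a b) u v := by
        intro g
        rw [pairStep_sub, pairStep_const hP]
      rw [Nat.succ_add, meetProb_succ_of_ne P _ h, meetProb_succ_of_ne P _ h, hsub, hsub,
        ← pairStep_const_mul]
      exact pairStep_mono hP ih u v

/-- If any two walks may meet within `B` steps, then expected meeting times are finite. -/
theorem sum_one_sub_meetProb_le {P : V → V → ℝ} (hP : IsStoch P) {B : ℕ} (hB : 1 ≤ B) {ε : ℝ}
    (hε : 0 < ε) (h : ∀ a b, ε ≤ meetProb P B a b) (u v : V) (n : ℕ) :
    ∑ t ∈ Finset.range n, (1 - meetProb P t u v) ≤ B / ε := by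
  have hε1 : ε ≤ 1 := (h u v).trans (meetProb_le_one hP B u v)
  have hgeom : ∀ J a b, 1 - meetProb P (J * B) a b ≤ (1 - ε) ^ J := by
    intro J
    induction J with
    | zero => intro a b; simpa using meetProb_nonneg hP 0 a b
    | succ J ih =>
      intro a b
      rw [Nat.succ_mul, Nat.add_comm, pow_succ]
      refine (one_sub_meetProb_add_le hP ih B a b).trans ?_
      exact mul_le_mul_of_nonneg_left (by linarith [h a b]) (pow_nonneg (by linarith) J)
  have hblock : ∀ J, ∑ t ∈ Finset.range (J * B), (1 - meetProb P t u v) ≤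
      B * (1 - (1 - ε) ^ J) / ε := by
    intro J
    induction J with
    | zero => simp
    | succ J ih =>
      rw [Nat.succ_mul, Finset.sum_range_add]
      have h1 : ∑ i ∈ Finset.range B, (1 - meetProb P (J * B + i) u v) ≤ B * (1 - ε) ^ J := by
        calc _ ≤ ∑ i ∈ Finset.range B, (1 - ε) ^ J := Finset.sum_le_sum fun i _ => by
              linarith [hgeom J u v, meetProb_mono hP (Nat.le_add_right (J * B) i) u v]
          _ = _ := by simp
      have h2 : B * (1 - (1 - ε) ^ (J + 1)) / ε =
          B * (1 - (1 - ε) ^ J) / ε + B * (1 - ε) ^ J := by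
        field_simp
        ring
      rw [h2]
      exact add_le_add ih h1
  refine le_trans (Finset.sum_le_sum_of_subset_of_nonneg
    (Finset.range_mono (Nat.le_mul_of_pos_right n hB)) fun t _ _ =>
      sub_nonneg.2 (meetProb_le_one hP t u v)) ((hblock n).trans ?_)
  refine div_le_div_of_nonneg_right ?_ hε.le
  have h3 : 0 ≤ (1 - ε) ^ n := pow_nonneg (by linarith) n
  have h4 : (0 : ℝ) ≤ B := Nat.cast_nonneg B
  nlinarith

end Mixing

section Graph

variable {V : Type*} [Fintype V] [DecidableEq V] (G : SimpleGraph V) [DecidableRel G.Adj]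

/-- The stationary distribution, proportional to the degree. -/
noncomputable def degDist (v : V) : ℝ := G.degree v / ∑ u, (G.degree u : ℝ)

theorem degree_mul_stepMat (u v : V) :
    (G.degree u : ℝ) * stepMat G u v = G.degree v * stepMat G v u := by
  rcases eq_or_ne u v with rfl | huv
  · rfl
  by_cases hadj : G.Adj u v
  · have hu : G.degree u ≠ 0 := (G.degree_pos_iff_exists_adj u).2 ⟨v, hadj⟩ |>.ne'
    have hv : G.degree v ≠ 0 := (G.degree_pos_iff_exists_adj v).2 ⟨u, hadj.symm⟩ |>.ne'
    simp only [stepMat, transition, hu, hv, huv, huv.symm, hadj, hadj.symm, if_true, if_false,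
      one_div, ENNReal.toReal_inv, ENNReal.toReal_mul, ENNReal.toReal_ofNat,
      ENNReal.toReal_natCast]
    have hu' : (G.degree u : ℝ) ≠ 0 := by exact_mod_cast hu
    have hv' : (G.degree v : ℝ) ≠ 0 := by exact_mod_cast hv
    field_simp
  · have hadj' : ¬ G.Adj v u := fun h => hadj h.symm
    simp [stepMat, transition, huv, huv.symm, hadj, hadj']

theorem stepMat_self_pos (v : V) : 0 < stepMat G v v := by
  by_cases h : G.degree v = 0 <;> simp [stepMat, transition, h]

theorem stepMat_pos_of_adj {u v : V} (h : G.Adj u v) : 0 < stepMat G u v := by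
  have hu : G.degree u ≠ 0 := (G.degree_pos_iff_exists_adj u).2 ⟨v, h⟩ |>.ne'
  have hu' : (0 : ℝ) < G.degree u := by exact_mod_cast Nat.pos_of_ne_zero hu
  simp only [stepMat, transition, hu, h.ne', h, if_true, if_false, one_div, ENNReal.toReal_inv,
    ENNReal.toReal_mul, ENNReal.toReal_ofNat, ENNReal.toReal_natCast]
  positivity

/-- One walk follows a path to the starting vertex of the other one, which waits there. -/
theorem meetProb_length_pos {u v : V} (w : G.Walk u v) :
    0 < meetProb (stepMat G) w.length u v := by
  have hP := isStoch_stepMat G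
  induction w with
  | nil => simp [meetProb]
  | @cons a b c hab w ih =>
    refine lt_of_lt_of_le ?_ (pairStep_meetProb_le hP w.length a c)
    refine lt_of_lt_of_le
      (mul_pos (mul_pos (stepMat_pos_of_adj G hab) (stepMat_self_pos G c)) ih) ?_
    have hnn : ∀ x y, 0 ≤ stepMat G a x * stepMat G c y * meetProb (stepMat G) w.length x y :=
      fun x y => mul_nonneg (mul_nonneg (hP.nonneg _ _) (hP.nonneg _ _)) (meetProb_nonneg hP _ _ _)
    exact (Finset.single_le_sum (fun y _ => hnn b y) (Finset.mem_univ c)).trans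
      (Finset.single_le_sum (f := fun x => ∑ y, stepMat G a x * stepMat G c y *
        meetProb (stepMat G) w.length x y)
        (fun x _ => Finset.sum_nonneg fun y _ => hnn x y) (Finset.mem_univ b))

variable {G}

theorem exists_le_meetProb (hG : G.Connected) :
    ∃ B : ℕ, 1 ≤ B ∧ ∃ ε > 0, ∀ u v, ε ≤ meetProb (stepMat G) B u v := by
  have hP := isStoch_stepMat G
  have := hG.nonempty
  choose w hw using fun x : V × V => hG.exists_walk_length_eq_dist x.1 x.2
  set B := (Finset.univ.sup fun x : V × V => (w x).length) + 1 with hB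
  obtain ⟨x, hx⟩ := Finite.exists_min fun x : V × V => meetProb (stepMat G) B x.1 x.2
  refine ⟨B, by omega, meetProb (stepMat G) B x.1 x.2, ?_, fun u v => hx (u, v)⟩
  refine lt_of_lt_of_le (meetProb_length_pos G (w x)) (meetProb_mono hP ?_ _ _)
  exact (Finset.le_sup (f := fun x : V × V => (w x).length) (Finset.mem_univ x)).trans
    (Nat.le_succ _)

theorem degree_pos [Nontrivial V] (hG : G.Connected) (v : V) : 0 < G.degree v :=
  hG.preconnected.degree_pos_of_nontrivial v

theorem degDist_pos [Nontrivial V] (hG : G.Connected) (v : V) : 0 < degDist G v := by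
  have h : ∀ u, (0 : ℝ) < G.degree u := fun u => by exact_mod_cast degree_pos hG u
  exact div_pos (h v) (Finset.sum_pos (fun u _ => h u) Finset.univ_nonempty)

theorem degDist_reversible (u v : V) :
    degDist G u * stepMat G u v = degDist G v * stepMat G v u := by
  rw [degDist, degDist, div_mul_eq_mul_div, div_mul_eq_mul_div, degree_mul_stepMat]

theorem isStationary_degDist [Nontrivial V] (hG : G.Connected) :
    IsStationary (stepMat G) (degDist G) := by
  refine ⟨fun v => (degDist_pos hG v).le, ?_, fun v => ?_⟩
  · have h : ∀ u, (0 : ℝ) < G.degree u := fun u => by exact_mod_cast degree_pos hG u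
    have hs : 0 < ∑ u, (G.degree u : ℝ) := Finset.sum_pos (fun u _ => h u) Finset.univ_nonempty
    simp only [degDist]
    rw [← Finset.sum_div, div_self hs.ne']
  · simp only [degDist_reversible _ v]
    rw [← Finset.mul_sum, (isStoch_stepMat G).sum_eq_one, mul_one]

variable [MeasurableSpace V] [DiscreteMeasurableSpace V]

theorem tMeet_ne_top (hG : G.Connected) : tMeet G ≠ ∞ := by
  have hP := isStoch_stepMat G
  obtain ⟨B, hB, ε, hε, h⟩ := exists_le_meetProb hG
  refine ne_top_of_le_ne_top (ENNReal.ofReal_ne_top (r := B / ε)) (iSup₂_le fun u v => ?_)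
  rw [meet_eq_tsum]
  refine ENNReal.tsum_le_of_sum_range_le fun n => ?_
  rw [← ENNReal.ofReal_sum_of_nonneg fun t _ => sub_nonneg.2 (meetProb_le_one hP t u v)]
  exact ENNReal.ofReal_le_ofReal (sum_one_sub_meetProb_le hP hB hε h u v n)

/-- Markov's inequality for the meeting time. -/
theorem mul_one_sub_meetProb_le (hG : G.Connected) (N : ℕ) (u v : V) :
    N * (1 - meetProb (stepMat G) N u v) ≤ (tMeet G).toReal := by
  have hP := isStoch_stepMat G
  have hnn : ∀ t, 0 ≤ 1 - meetProb (stepMat G) t u v := fun t =>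
    sub_nonneg.2 (meetProb_le_one hP t u v)
  rw [← ENNReal.ofReal_le_iff_le_toReal (tMeet_ne_top hG)]
  refine le_trans ?_ (le_iSup₂ (f := fun u v => meet G u v) u v)
  rw [meet_eq_tsum]
  refine le_trans ?_ (ENNReal.sum_le_tsum (Finset.range N))
  rw [← ENNReal.ofReal_sum_of_nonneg fun t _ => hnn t]
  refine ENNReal.ofReal_le_ofReal ?_
  calc N * (1 - meetProb (stepMat G) N u v)
      = ∑ t ∈ Finset.range N, (1 - meetProb (stepMat G) N u v) := by
        rw [Finset.sum_const, Finset.card_range, nsmul_eq_mul]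
    _ ≤ _ := Finset.sum_le_sum fun t ht =>
        sub_le_sub_left (meetProb_mono hP (Finset.mem_range.1 ht).le u v) 1

theorem one_le_tMeet [Nontrivial V] (hG : G.Connected) : 1 ≤ (tMeet G).toReal := by
  obtain ⟨u, v, huv⟩ := exists_pair_ne V
  rw [← ENNReal.toReal_one]
  refine ENNReal.toReal_mono (tMeet_ne_top hG) ?_
  refine le_trans ?_ (le_iSup₂ (f := fun u v => meet G u v) u v)
  rw [meet_eq_tsum]
  refine le_trans ?_ (ENNReal.le_tsum 0)
  simp [meetProb_zero_of_ne _ huv]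

theorem tvDist_le_dBar (t : ℕ) (u v : V) :
    tvDist (stepPow (stepMat G) t u) (stepPow (stepMat G) t v) ≤ dBar G t := by
  have h : ∀ u v, tvDist (prob G t u) (prob G t v) =
      tvDist (stepPow (stepMat G) t u) (stepPow (stepMat G) t v) := by
    intro u v
    simp only [tvDist, prob_eq_stepPow]
  rw [← h]
  refine le_trans ?_ (le_ciSup (f := fun u => ⨆ v, tvDist (prob G t u) (prob G t v))
    (Set.finite_range _).bddAbove u)
  exact le_ciSup (f := fun v => tvDist (prob G t u) (prob G t v)) (Set.finite_range _).bddAbove v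

theorem dBar_tMix_le (hG : G.Connected) : dBar G (tMix G) ≤ 1 / Real.exp 1 := by
  have hP := isStoch_stepMat G
  have := hG.nonempty
  have hne : {t : ℕ | dBar G t ≤ 1 / Real.exp 1}.Nonempty := by
    obtain ⟨N, hN⟩ := exists_nat_gt ((tMeet G).toReal * Real.exp 1)
    have hN0 : (0 : ℝ) < N := lt_of_le_of_lt (by positivity) hN
    refine ⟨N, ?_⟩
    rw [Set.mem_ofPred_eq, dBar]
    refine ciSup_le fun u => ciSup_le fun v => ?_
    have h1 : tvDist (prob G N u) (prob G N v) ≤ 1 - meetProb (stepMat G) N u v := by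
      have := tvDist_stepPow_le hP N u v
      simpa only [tvDist, prob_eq_stepPow] using this
    refine h1.trans ?_
    have h2 := mul_one_sub_meetProb_le hG N u v
    rw [le_div_iff₀ (Real.exp_pos 1)]
    have h3 := mul_le_mul_of_nonneg_right h2 (Real.exp_pos 1).le
    refine le_of_mul_le_mul_left ?_ hN0
    linarith
  exact Nat.sInf_mem hne

theorem one_div_exp_one_le : 1 / Real.exp 1 ≤ 1 / 2 :=
  one_div_le_one_div_of_le two_pos (by linarith [Real.add_one_le_exp 1])

theorem one_le_tMix [Nontrivial V] (hG : G.Connected) : 1 ≤ tMix G := by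
  by_contra h
  have h0 : tMix G = 0 := by omega
  obtain ⟨u, v, huv⟩ := exists_pair_ne V
  have h1 := (tvDist_le_dBar (G := G) 0 u v).trans
    ((h0 ▸ dBar_tMix_le hG).trans one_div_exp_one_le)
  have hs := isStoch_stepPow (isStoch_stepMat G) 0
  have h2 : ∀ x, min (stepPow (stepMat G) 0 u x) (stepPow (stepMat G) 0 v x) = 0 := by
    intro x
    simp only [stepPow]
    by_cases hx : x = u
    · simp [hx, huv]
    · simp only [hx, if_false]
      exact min_eq_left (by split_ifs <;> norm_num)
  rw [tvDist_eq_one_sub_sum_min (hs.sum_eq_one u) (hs.sum_eq_one v)] at h1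
  simp only [h2, Finset.sum_const_zero] at h1
  norm_num at h1

theorem mul_degDist_le_stepPow [Nontrivial V] (hG : G.Connected) (u v : V) :
    1 / 4 * degDist G v ≤ stepPow (stepMat G) (tMix G + tMix G) u v :=
  mul_le_stepPow_add_self (isStoch_stepMat G) (isStationary_degDist hG) (degDist_pos hG)
    degDist_reversible
    ((tvDist_le_dBar (tMix G) u v).trans ((dBar_tMix_le hG).trans one_div_exp_one_le))

theorem half_le_meetProb (hG : G.Connected) {N : ℕ} (hN : 0 < N)
    (h : 2 * (tMeet G).toReal ≤ N) (u v : V) : 1 / 2 ≤ meetProb (stepMat G) N u v := by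
  have h1 := mul_one_sub_meetProb_le hG N u v
  have hN0 : (0 : ℝ) < N := by exact_mod_cast hN
  have h2 : (N : ℝ) * (1 - meetProb (stepMat G) N u v) ≤ N * (1 / 2) := by linarith
  linarith [le_of_mul_le_mul_left h2 hN0]

/-- Two stationary walks meet within a mixing time with probability of order
`tMix / tMeet` at least. -/
theorem div_le_statMeet [Nontrivial V] (hG : G.Connected)
    (h : (tMix G : ℝ) ≤ (tMeet G).toReal) :
    (tMix G : ℝ) / (8 * (tMeet G).toReal) ≤ statMeet (stepMat G) (degDist G) (tMix G) := by
  have hP := isStoch_stepMat G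
  have hπ := isStationary_degDist hG
  set M := (tMeet G).toReal with hM
  have hM1 : 1 ≤ M := one_le_tMeet hG
  have hT := one_le_tMix hG
  set T := tMix G with hTdef
  have hT0 : (1 : ℝ) ≤ T := by exact_mod_cast hT
  set N := ⌈2 * M⌉₊ with hN
  have hN1 : 2 * M ≤ N := Nat.le_ceil _
  have hN2 : (N : ℝ) ≤ 3 * M := by linarith [Nat.ceil_lt_add_one (by linarith : 0 ≤ 2 * M)]
  have hN0 : 0 < N := Nat.ceil_pos.2 (by linarith)
  have h1 : 1 / 2 ≤ statMeet (stepMat G) (degDist G) N := by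
    have h2 := hπ.sum_le fun x => hπ.sum_le fun y => half_le_meetProb hG hN0 hN1 x y
    simp only [hπ.sum_const] at h2
    exact h2
  have hle : N ≤ (N / T + 1) * T := by
    rw [Nat.add_mul, one_mul, mul_comm]
    have := Nat.div_add_mod N T
    have := Nat.mod_lt N (by omega : 0 < T)
    omega
  have h2 := h1.trans ((statMeet_mono hP hπ hle).trans (statMeet_mul_le hP hπ T (N / T)))
  have h3 : ((N / T : ℕ) : ℝ) ≤ N / T := Nat.cast_div_le
  have h4 : ((N / T : ℕ) : ℝ) + 1 ≤ 4 * M / T := by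
    have h5 : (N : ℝ) / T ≤ 3 * M / T := div_le_div_of_nonneg_right hN2 (by linarith)
    have h6 : 1 ≤ M / T := (one_le_div (by linarith)).2 h
    have h7 : 4 * M / T = 3 * M / T + M / T := by ring
    linarith
  have h5 := h2.trans (mul_le_mul_of_nonneg_right h4 (statMeet_nonneg hP hπ T))
  rw [div_mul_eq_mul_div, le_div_iff₀ (by linarith)] at h5
  rw [div_le_iff₀ (by linarith)]
  linarith

theorem tCoal_le_ofReal [Nonempty V] {K : ℝ}
    (h : ∀ n, ∑ t ∈ Finset.range n, flowExp (stepMat G) t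
      (fun g => if ((Finset.univ : Finset V).image g).card ≠ 1 then 1 else 0) ≤ K) :
    tCoal G ≤ ENNReal.ofReal K := by
  rw [tCoal_eq_tsum]
  refine ENNReal.tsum_le_of_sum_range_le fun n => ?_
  rw [← ENNReal.ofReal_sum_of_nonneg fun t _ => flowExp_nonneg (isStoch_stepMat G) t fun g => by
    split_ifs <;> norm_num]
  exact ENNReal.ofReal_le_ofReal (h n)

theorem tCoal_le [Nontrivial V] (hG : G.Connected) :
    tCoal G ≤ ENNReal.ofReal (61440 * ((tMeet G).toReal *
      (1 + √((tMix G : ℝ) / (tMeet G).toReal) * Real.log (Fintype.card V)))) := by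
  have hP := isStoch_stepMat G
  have hπ := isStationary_degDist hG
  set M := (tMeet G).toReal with hM
  set X : ℝ := (tMix G : ℝ) with hX
  set L := Real.log (Fintype.card V) with hL
  have hM1 : 1 ≤ M := one_le_tMeet hG
  have hX1 : 1 ≤ X := by
    rw [hX]
    exact_mod_cast one_le_tMix hG
  have hL0 : 0 ≤ L := Real.log_nonneg (by exact_mod_cast Fintype.card_pos)
  refine tCoal_le_ofReal fun n => ?_
  rcases lt_or_ge M X with h | h
  · set N := ⌈2 * M⌉₊ with hN
    have hN1 : 2 * M ≤ N := Nat.le_ceil _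
    have hN2 : (N : ℝ) ≤ 3 * M := by linarith [Nat.ceil_lt_add_one (by linarith : 0 ≤ 2 * M)]
    have hN0 : 0 < N := Nat.ceil_pos.2 (by linarith)
    refine (sum_card_ne_one_le_of_half_le_meetProb hP hN0 (half_le_meetProb hG hN0 hN1)
      Finset.univ_nonempty n).trans ?_
    rw [Finset.card_univ, ← hL]
    have hr : 1 ≤ √(X / M) := by
      rw [Real.one_le_sqrt]
      exact (one_le_div (by linarith)).2 h.le
    have h1 : L ≤ √(X / M) * L := le_mul_of_one_le_left hL0 hr
    calc 6 * N * L ≤ 6 * (3 * M) * (√(X / M) * L) := by gcongr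
      _ = 18 * (M * (√(X / M) * L)) := by ring
      _ ≤ 61440 * (M * (1 + √(X / M) * L)) := by
        have : 0 ≤ M * (√(X / M) * L) := by positivity
        linarith
  · have hp := div_le_statMeet hG h
    rw [← hX, ← hM] at hp
    set p := statMeet (stepMat G) (degDist G) (tMix G) with hpdef
    have hp0 : 0 < p := lt_of_lt_of_le (by positivity) hp
    refine (sum_card_ne_one_le_of_statMeet hP hπ (s := tMix G + tMix G) (T := tMix G)
      (by have := one_le_tMix hG; omega) hp0 (mul_degDist_le_stepPow hG)
      Finset.univ_nonempty n).trans ?_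
    rw [Finset.card_univ, ← hL, ← hpdef]
    have h1 : 1 / p ≤ 8 * M / X := by
      rw [div_le_div_iff₀ hp0 (by linarith)]
      rw [div_le_iff₀ (by linarith)] at hp
      linarith
    have h2 : 1 / √p ≤ 8 * √(M / X) := by
      rw [← Real.sqrt_one, ← Real.sqrt_div zero_le_one]
      refine Real.sqrt_le_iff.2 ⟨by positivity, ?_⟩
      rw [mul_pow, Real.sq_sqrt (by positivity)]
      have : 0 ≤ M / X := by positivity
      have h3 : 8 * M / X = 8 * (M / X) := by ring
      linarith
    have h3 : X * √(M / X) = M * √(X / M) := by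
      rw [Real.sqrt_div (by linarith), Real.sqrt_div (by linarith)]
      have hXs := Real.mul_self_sqrt (by linarith : 0 ≤ X)
      have hMs := Real.mul_self_sqrt (by linarith : 0 ≤ M)
      have hXp : 0 < √X := Real.sqrt_pos.2 (by linarith)
      have hMp : 0 < √M := Real.sqrt_pos.2 (by linarith)
      rw [← mul_div_assoc, ← mul_div_assoc, div_eq_div_iff hXp.ne' hMp.ne']
      calc X * √M * √M = X * (√M * √M) := by ring
        _ = M * (√X * √X) := by rw [hMs, hXs]; ring
        _ = _ := by ring
    have hcast : ((tMix G + tMix G + tMix G : ℕ) : ℝ) = 3 * X := by push_cast; ring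
    rw [hcast]
    calc 2560 * (3 * X) * (1 / p + L / √p) = 7680 * X * (1 / p + 1 / √p * L) := by ring
      _ ≤ 7680 * X * (8 * M / X + 8 * √(M / X) * L) := by gcongr
      _ = 61440 * (X * (M / X) + X * √(M / X) * L) := by ring
      _ = _ := by
        rw [h3, mul_div_cancel₀ M (by linarith : X ≠ 0)]
        ring

end Graph

end LazyWalk

theorem theorem1p1 :
    ∃ C : ℝ, 0 < C ∧
      ∀ (V : Type*) [Fintype V] [DecidableEq V] [MeasurableSpace V] [DiscreteMeasurableSpace V]
        (G : SimpleGraph V) [DecidableRel G.Adj], G.Connected →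
        LazyWalk.tMeet G ≠ ∞ ∧ LazyWalk.tCoal G ≠ ∞ ∧
        (LazyWalk.tCoal G).toReal ≤
          C * ((LazyWalk.tMeet G).toReal *
            (1 + √((LazyWalk.tMix G : ℝ) / (LazyWalk.tMeet G).toReal) *
              Real.log (Fintype.card V))) ∧
        ((LazyWalk.tMix G : ℝ) * Real.log (Fintype.card V) ^ 2 ≤ (LazyWalk.tMeet G).toReal →
          (LazyWalk.tCoal G).toReal ≤ C * (LazyWalk.tMeet G).toReal) := by
  refine ⟨122880, by norm_num, ?_⟩
  intro V _ _ _ _ G _ hG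
  have := hG.nonempty
  have hL0 : 0 ≤ Real.log (Fintype.card V) := Real.log_nonneg (by exact_mod_cast Fintype.card_pos)
  have hM0 : 0 ≤ (LazyWalk.tMeet G).toReal := ENNReal.toReal_nonneg
  refine ⟨LazyWalk.tMeet_ne_top hG, ?_⟩
  rcases subsingleton_or_nontrivial V with hV | hV
  · -- a single particle: the coalescence time is `0`
    have h0 : LazyWalk.tCoal G = 0 := by
      have h := LazyWalk.tCoal_le_ofReal (G := G) (K := 0) fun n => by
        refine (Finset.sum_eq_zero fun t _ => ?_).le
        have hcard : ∀ g : V → V, ((Finset.univ : Finset V).image g).card = 1 := fun g =>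
          le_antisymm (Finset.card_le_one_of_subsingleton _)
            (Finset.card_pos.2 (Finset.univ_nonempty.image g))
        simp only [hcard, ne_eq, not_true, if_false,
          LazyWalk.flowExp_const (LazyWalk.isStoch_stepMat G)]
      simpa using h
    rw [h0]
    refine ⟨ENNReal.zero_ne_top, ?_, fun _ => ?_⟩ <;> rw [ENNReal.toReal_zero] <;> positivity
  · have hle := LazyWalk.tCoal_le hG
    have hM1 := LazyWalk.one_le_tMeet hG
    set M := (LazyWalk.tMeet G).toReal with hM
    set X : ℝ := (LazyWalk.tMix G : ℝ) with hX
    set L := Real.log (Fintype.card V) with hL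
    have hK0 : 0 ≤ M * (1 + √(X / M) * L) := by positivity
    have hreal : (LazyWalk.tCoal G).toReal ≤ 61440 * (M * (1 + √(X / M) * L)) :=
      ENNReal.toReal_le_of_le_ofReal (by positivity) hle
    refine ⟨ne_top_of_le_ne_top ENNReal.ofReal_ne_top hle, by linarith, fun h => ?_⟩
    have h1 : √(X / M) * L ≤ 1 := by
      rw [← Real.sqrt_sq hL0, ← Real.sqrt_mul (by positivity)]
      refine Real.sqrt_le_one.2 ?_
      rw [div_mul_eq_mul_div]
      exact (div_le_one (by linarith)).2 h
    have h2 := mul_le_mul_of_nonneg_left h1 hM0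
    linarith
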